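/- Let $\mathbb H$ be the quaternions with units $\mathbf i,\mathbf j,\mathbf k$, let $S^3\subset\mathbb H$ be the unit sphere, $r$ the radial function, and for a unit imaginary quaternion $\mathbf c$ let $\alpha_{\mathbf c}=-2\,dr\circ\mathbf c|_{TS^3}$, where $\mathbf c$ acts by left multiplication. Identify $\mathbb R^3$ with the imaginary quaternions, let $S^2\subset\mathbb R^3$ be the unit sphere with round metric $g_0$ and area form $\sigma_0$, and write $T^*S^2\setminus S^2=\{(\mathbf x,\mathbf y)\in\mathbb R^3\times\mathbb R^3:\ |\mathbf x|=1,\ \langle\mathbf x,\mathbf y\rangle=0,\ \mathbf y\ne0\}$ for the cotangent bundle without its zero section ($(\mathbf x,\mathbf y)$ being the covector $\langle\mathbf y,\cdot\rangle$ at $\mathbf x$), with projection $\pi$ to $S^2$, $\rho=|\mathbf y|$ and $ST^*S^2=\{\rho=1\}$. Let $\lambda$ be the Liouville form, $\lambda(\dot{\mathbf x},\dot{\mathbf y})=\langle\mathbf y,\dot{\mathbf x}\rangle$, let $\alpha$ be the connection form on $ST^*S^2$, $\alpha(\dot{\mathbf x},\dot{\mathbf y})=-\langle\mathbf x\times\mathbf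 y,\dot{\mathbf y}\rangle$, pulled back to $T^*S^2\setminus S^2$ along $(\mathbf x,\mathbf y)\mapsto(\mathbf x,\mathbf y/|\mathbf y|)$, and put $$\omega^\theta=\sin\theta\,d\lambda+\cos\theta\,d(\rho\alpha).$$ Hamiltonian vector fields are defined by $\omega(X_H,\cdot)=-dH$. Let $\Phi(\mathbf u)=(\bar{\mathbf u}\mathbf i\mathbf u,\bar{\mathbf u}\mathbf k\mathbf u)$ for $\mathbf u\in S^3$, extended to $\tilde\Phi:\mathbb H\setminus\{0\}\to T^*S^2\setminus S^2$, $\tilde\Phi(\mathbf u)=(|\mathbf u|^{-2}\bar{\mathbf u}\mathbf i\mathbf u,\bar{\mathbf u}\mathbf k\mathbf u)$. Let $\mathbf a_\theta=\cos\frac\theta2+\mathbf k\sin\frac\theta2$ and $l_{\mathbf a}(\mathbf u)=\mathbf a\mathbf u$. A flow doubly covers another one if it is semiconjugate to it by a smooth two-sheeted covering. **Theorem.** The forms $\alpha_{\mathbf i},\alpha_{\mathbf j}$ and $\alpha^\theta=\cos\theta\,\alpha_{\mathbf i}+\sin\theta\,\alpha_{\mathbf j}$ ($\theta\in\mathbb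 R$) are contact forms on $S^3$. The maps $l_{\mathbf a_\theta}$ define an action of the circle $\mathbb R/4\pi\mathbb Z$ on $S^3$, and the push-forward of $\alpha_{\mathbf i}$ under $l_{\mathbf a_\theta}$ is $\alpha^\theta$. All $\omega^\theta$ are symplectic. Every orbit of the Reeb flow of $\alpha^\theta$ is periodic with minimal period $4\pi$, and via $\Phi$ this flow doubly covers the Hamiltonian flow of $\frac12|\mathbf y|^2$ with respect to $\omega^\theta$ on $ST^*S^2$. If $\sin\theta\neq0$, the latter flow, with time $t$ replaced by $t/\sin\theta$, is the magnetic flow of $(g_0,-\cot\theta\,\sigma_0)$ on $ST^*S^2$, i.e. the Hamiltonian flow of $\frac12|\mathbf y|^2$ with respect to $d\lambda+\cot\theta\,\pi^*\sigma_0$. Write $\mathbf u=z_0+z_1\mathbf j$ with $z_m=x_m+y_m\mathbf i$. For $\varepsilon\in[0,1)$ the forms $$\alpha_{\mathbf i,\varepsilon}=\tfrac{2}{1+\varepsilon}(x_0\,dy_0-y_0\,dx_0)+\tfrac{2}{1-\varepsilon}(x_1\,dy_1-y_1\,dx_1)$$ are a smooth deformation of $\alpha_{\mathbf i}=\alpha_{\mathbf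 i,0}$ through contact forms on $S^3$; their push-forwards $\alpha^\theta_\varepsilon$ under $l_{\mathbf a_\theta}$ are contact forms which depend on $\theta$ only modulo $2\pi$. The function $$H^\theta_\varepsilon(\mathbf x,\mathbf y)=|\mathbf y|+\varepsilon\bigl(\cos\theta\,|\mathbf y|\,\langle\mathbf x,\mathbf i\rangle-\sin\theta\,\langle\mathbf x\times\mathbf y,\mathbf i\rangle\bigr)$$ on $T^*S^2\setminus S^2$ is smooth in $(\varepsilon,\mathbf x,\mathbf y)$, equals $|\mathbf y|$ for $\varepsilon=0$, and satisfies $H^\theta_\varepsilon\circ\tilde\Phi=H_\varepsilon\circ l_{\bar{\mathbf a}_\theta}$ with $H_\varepsilon=(1+\varepsilon)|z_0|^2+(1-\varepsilon)|z_1|^2$. Moreover, for all $\theta$ and all $\varepsilon\in[0,1)$: (i) The Reeb flow of $\alpha^\theta_\varepsilon$ on $S^3$ doubly covers the Hamiltonian flow of $H^\theta_\varepsilon$ with respect to $\omega^\theta$ on the level set $\{H^\theta_\varepsilon=1\}$. The covering is $\tilde\Phi\circ l_{\mathbf a_\theta}\circ E_\varepsilon\circ l_{\bar{\mathbf a}_\theta}$,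 where $E_\varepsilon(z_0,z_1)=(z_0/\sqrt{1+\varepsilon},z_1/\sqrt{1-\varepsilon})$. (ii) If $\varepsilon$ is irrational, this Hamiltonian flow on $\{H^\theta_\varepsilon=1\}$ has precisely two periodic orbits. (iii) There is $\varepsilon_0>0$ such that for $\theta\equiv\pi/2$ mod $\pi$ and $\varepsilon<\varepsilon_0$ this Hamiltonian flow is the geodesic flow of a Finsler metric $G$ on $S^2$, where $(\mathbf x,\mathbf y)$ is identified with the $G$-unit tangent vector whose Legendre transform is $(\mathbf x,\sin\theta\,\mathbf y)$ (so covectors are reversed when $\theta\equiv-\pi/2$ mod $2\pi$, where $\omega^\theta=-d\lambda$). The metric $G$ is a Randers metric (the norm of some Riemannian metric plus a $1$-form), its dual norm is $(\mathbf x,\mathbf y)\mapsto H^\theta_\varepsilon(\mathbf x,\sin\theta\,\mathbf y)$, and $H^\theta_\varepsilon(\mathbf x,\mathbf y)=|\mathbf y|-\varepsilon\sin\theta\,\langle\mathbf y,\mathbf i\times\mathbf x\rangle$, that is, the norm plus a multiple of the evaluation on a rotation field. -/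

import Mathlib

open Set Real
open scoped Quaternion ContDiff RealInnerProductSpace

noncomputable section

namespace QuatMagnetic

/-! ### Forms, vector fields and flows on embedded submanifolds

A submanifold `M` of a normed space `E` is given as a set together with its family `T` of tangent
spaces.  A `1`-form on `M` is the restriction to `M` and `T` of a form that is defined on a
neighbourhood of `M` in `E`; restriction commutes with the exterior derivative. -/

section General

variable {E F : Type*} [NormedAddCommGroup E] [NormedSpace ℝ E]
  [NormedAddCommGroup F] [NormedSpace ℝ F]

/-- `f` is smooth on an open neighbourhood of `M`. -/
def SmoothNear (M : Set E) (f : E → F) : Prop :=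
  ∃ U : Set E, IsOpen U ∧ M ⊆ U ∧ ContDiffOn ℝ ∞ f U

/-- The exterior derivative `(dβ)_p(v, w)` of a `1`-form `β`. -/
def dForm (β : E → E →L[ℝ] ℝ) (p v w : E) : ℝ :=
  extDeriv (fun q => ContinuousAlternatingMap.ofSubsingleton ℝ E ℝ (0 : Fin 1) (β q)) p ![v, w]

/-- The pull-back `f^*β` of a `1`-form. -/
def pullback (f : E → F) (β : F → F →L[ℝ] ℝ) (p : E) : E →L[ℝ] ℝ :=
  (β (f p)).comp (fderiv ℝ f p)

/-- The `3`-form `β ∧ dβ`. -/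
def wedgeD (β : E → E →L[ℝ] ℝ) (p a b c : E) : ℝ :=
  β p a * dForm β p b c + β p b * dForm β p c a + β p c * dForm β p a b

/-- `β` is a contact form on the `3`-manifold `M`: the `3`-form `β ∧ dβ` vanishes nowhere. -/
def IsContactForm (M : Set E) (T : E → Set E) (β : E → E →L[ℝ] ℝ) : Prop :=
  SmoothNear M β ∧ ∀ p ∈ M, ∃ a ∈ T p, ∃ b ∈ T p, ∃ c ∈ T p, wedgeD β p a b c ≠ 0

/-- `R` is the value at `p` of the Reeb vector field of `β`: `β(R) = 1` and `dβ(R, ·) = 0`. -/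
def IsReebVector (T : E → Set E) (β : E → E →L[ℝ] ℝ) (p R : E) : Prop :=
  R ∈ T p ∧ β p R = 1 ∧ ∀ w ∈ T p, dForm β p R w = 0

/-- `X` is the value at `p` of the Hamiltonian vector field of `H`: `Ω(X, ·) = -dH`. -/
def IsHamiltonianVector (T : E → Set E) (Ω : E → E → E → ℝ) (H : E → ℝ) (p X : E) : Prop :=
  X ∈ T p ∧ ∀ w ∈ T p, Ω p X w = -(fderiv ℝ H p w)

/-- `φ` is the flow on `N` of the vector field whose value at `p` is the vector `X` with
`V p X`. -/
def IsFlowOf (N : Set E) (V : E → E → Prop) (φ : Flow ℝ N) : Prop :=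
  ∀ (p : N) (t : ℝ), ∃ X : E,
    HasDerivAt (fun s : ℝ => ((φ s p : N) : E)) X t ∧ V (φ t p : N) X

/-- `φ` is the Reeb flow of `β` on `M`. -/
def IsReebFlow (M : Set E) (T : E → Set E) (β : E → E →L[ℝ] ℝ) (φ : Flow ℝ M) : Prop :=
  IsFlowOf M (IsReebVector T β) φ

/-- `ψ` is the restriction to `N` (a level set of `H`) of the Hamiltonian flow of `H` with respect
to the `2`-form `Ω` on a manifold with tangent spaces `T`. -/
def IsHamiltonianFlow (N : Set E) (T : E → Set E) (Ω : E → E → E → ℝ) (H : E → ℝ)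
    (ψ : Flow ℝ N) : Prop :=
  IsFlowOf N (IsHamiltonianVector T Ω H) ψ

/-- The `2`-form `Ω` is nondegenerate on the manifold `M`. -/
def IsNondegenerate (M : Set E) (T : E → Set E) (Ω : E → E → E → ℝ) : Prop :=
  ∀ p ∈ M, ∀ v ∈ T p, (∀ w ∈ T p, Ω p v w = 0) → v = 0

/-- `f` restricts to a smooth, immersive, two-sheeted covering `M → N`. -/
structure IsDoubleCover (f : E → F) (M : Set E) (T : E → Set E) (N : Set F) : Prop where
  mapsTo : MapsTo f M N
  smooth : SmoothNear M f
  immersive : ∀ p ∈ M, ∀ v ∈ T p, fderiv ℝ f p v = 0 → v = 0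
  covering : IsCoveringMap (mapsTo.restrict f M N)
  two_sheeted : ∀ q ∈ N, {p | p ∈ M ∧ f p = q}.ncard = 2

/-- The flow `φ` on `M` doubly covers the flow `ψ` on `N` via `f`. -/
def DoublyCovers (f : E → F) (M : Set E) (T : E → Set E) (N : Set F)
    (φ : Flow ℝ M) (ψ : Flow ℝ N) : Prop :=
  ∃ h : IsDoubleCover f M T N, Flow.IsSemiconjugacy (h.mapsTo.restrict f M N) φ ψ

/-- The set of periodic orbits of a flow. -/
def periodicOrbits {X : Type*} [TopologicalSpace X] (ψ : Flow ℝ X) : Set (Set X) :=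
  {O | ∃ p : X, O = ψ.orbit p ∧ (∃ τ : ℝ, 0 < τ ∧ ψ τ p = p) ∧ ∃ t : ℝ, ψ t p ≠ p}

end General

/-! ### The `3`-sphere of unit quaternions -/

/-- The quaternionic units. -/
def qi : ℍ := ⟨0, 1, 0, 0⟩
def qj : ℍ := ⟨0, 0, 1, 0⟩
def qk : ℍ := ⟨0, 0, 0, 1⟩

/-- The unit sphere in the quaternions and its tangent spaces. -/
def S3 : Set ℍ := {u | ‖u‖ = 1}
def TS3 (u : ℍ) : Set ℍ := {v | ⟪u, v⟫ = 0}

/-- `α_c = -2 dr ∘ c`, where `c` acts by left multiplication; `dr_u = ⟪u, ·⟫` for `u` in `S3`. -/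
def alpha (c u : ℍ) : ℍ →L[ℝ] ℝ :=
  (-2 : ℝ) • (innerSL ℝ u).comp (ContinuousLinearMap.mul ℝ ℍ c)

/-- `α^θ = cos θ α_i + sin θ α_j`. -/
def alphaTheta (θ : ℝ) (u : ℍ) : ℍ →L[ℝ] ℝ := cos θ • alpha qi u + sin θ • alpha qj u

/-- The circle of unit quaternions `cos (θ/2) + sin (θ/2) k`. -/
def rot (θ : ℝ) : ℍ := ⟨cos (θ / 2), 0, 0, sin (θ / 2)⟩

/-- Push-forward of a `1`-form under the left multiplication `u ↦ rot θ * u`, whose inverse is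
the left multiplication by the conjugate quaternion. -/
def pushRot (θ : ℝ) (β : ℍ → ℍ →L[ℝ] ℝ) : ℍ → ℍ →L[ℝ] ℝ :=
  pullback (fun u => star (rot θ) * u) β

/-- With `u = x₀ + y₀ i + x₁ j + y₁ k` this is the `1`-form
`2/(1+ε) (x₀ dy₀ - y₀ dx₀) + 2/(1-ε) (x₁ dy₁ - y₁ dx₁)`. -/
def alphaDef (ε : ℝ) (u : ℍ) : ℍ →L[ℝ] ℝ :=
  innerSL ℝ (⟨-(2 / (1 + ε) * u.imI), 2 / (1 + ε) * u.re,
    -(2 / (1 - ε) * u.imK), 2 / (1 - ε) * u.imJ⟩ : ℍ)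

/-- `α^θ_ε`, the push-forward of the deformed form. -/
def alphaThetaDef (θ ε : ℝ) : ℍ → ℍ →L[ℝ] ℝ := pushRot θ (alphaDef ε)

/-- The embedding of the sphere as the ellipsoid `(1+ε)|z₀|² + (1-ε)|z₁|² = 1`, where
`u = z₀ + z₁ j`. -/
def ellipsoid (ε : ℝ) (u : ℍ) : ℍ :=
  ⟨u.re / √(1 + ε), u.imI / √(1 + ε), u.imJ / √(1 - ε), u.imK / √(1 - ε)⟩

/-- `H_ε = (1+ε)|z₀|² + (1-ε)|z₁|²`. -/
def quadHam (ε : ℝ) (u : ℍ) : ℝ :=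
  (1 + ε) * (u.re ^ 2 + u.imI ^ 2) + (1 - ε) * (u.imJ ^ 2 + u.imK ^ 2)

/-! ### The cotangent bundle of the `2`-sphere

Euclidean `3`-space is the space of purely imaginary quaternions, and a pair `(x, y)` with
`⟪x, y⟫ = 0` stands for the covector `⟪y, ·⟫` on the tangent plane of the sphere at `x`. -/

/-- The cross product of imaginary quaternions. -/
def cross (x y : ℍ) : ℍ := (1 / 2 : ℝ) • (x * y - y * x)

/-- The unit sphere in the imaginary quaternions and its tangent planes. -/
def S2 : Set ℍ := {x | x.re = 0 ∧ ‖x‖ = 1}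
def TS2 (x : ℍ) : Set ℍ := {v | v.re = 0 ∧ ⟪x, v⟫ = 0}

/-- The cotangent bundle of the `2`-sphere without its zero section. -/
def cotS2 : Set (ℍ × ℍ) := {p | p.1 ∈ S2 ∧ p.2 ∈ TS2 p.1 ∧ p.2 ≠ 0}

/-- The tangent spaces of `cotS2`. -/
def TcotS2 (p : ℍ × ℍ) : Set (ℍ × ℍ) :=
  {v | v.1 ∈ TS2 p.1 ∧ v.2.re = 0 ∧ ⟪v.1, p.2⟫ + ⟪p.1, v.2⟫ = 0}

/-- The unit cotangent bundle. -/
def unitCot : Set (ℍ × ℍ) := {p | p ∈ cotS2 ∧ ‖p.2‖ = 1}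

/-- The Liouville form `λ_(x,y)(ẋ, ẏ) = ⟪y, ẋ⟫`. -/
def liouville (p : ℍ × ℍ) : ℍ × ℍ →L[ℝ] ℝ :=
  (innerSL ℝ p.2).comp (ContinuousLinearMap.fst ℝ ℍ ℍ)

/-- The form `ρ α`, where `ρ = ‖y‖` and `α` is the Levi-Civita connection form of the unit
cotangent bundle, `α_(x,y)(ẋ, ẏ) = ⟪-x × y, ẏ⟫` for `‖y‖ = 1`, pulled back under
`(x, y) ↦ (x, y / ‖y‖)`; the derivative of `1 / ‖y‖` does not contribute, as `x × y` is
orthogonal to `y`. -/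
def rhoConnection (p : ℍ × ℍ) : ℍ × ℍ →L[ℝ] ℝ :=
  (-‖p.2‖⁻¹) • (innerSL ℝ (cross p.1 p.2)).comp (ContinuousLinearMap.snd ℝ ℍ ℍ)

/-- `ω^θ = sin θ dλ + cos θ d(ρα)`. -/
def omegaTheta (θ : ℝ) (p v w : ℍ × ℍ) : ℝ :=
  sin θ * dForm liouville p v w + cos θ * dForm rhoConnection p v w

/-- The area form of the `2`-sphere. -/
def area (x v w : ℍ) : ℝ := ⟪x, cross v w⟫

/-- The magnetic form `dλ - π^*σ` for the magnetic field `σ = s • area`. -/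
def magneticForm (s : ℝ) (p v w : ℍ × ℍ) : ℝ :=
  dForm liouville p v w - s * area p.1 v.1 w.1

/-- The kinetic energy `½ ‖y‖²`. -/
def kinetic (p : ℍ × ℍ) : ℝ := ‖p.2‖ ^ 2 / 2

/-- The perturbed Hamiltonian `H^θ_ε`. -/
def ham (θ ε : ℝ) (p : ℍ × ℍ) : ℝ :=
  ‖p.2‖ + ε * (cos θ * (‖p.2‖ * p.1.imI) - sin θ * (cross p.1 p.2).imI)

/-- The level set `H^θ_ε = 1` in the cotangent bundle. -/
def level (θ ε : ℝ) : Set (ℍ × ℍ) := {p | p ∈ cotS2 ∧ ham θ ε p = 1}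

/-- The double covering `u ↦ (ū i u, ū k u)` of the unit cotangent bundle by the `3`-sphere. -/
def Phi (u : ℍ) : ℍ × ℍ := (star u * qi * u, star u * qk * u)

/-- The extension of `Phi` to nonzero quaternions, `r u ↦ r² • Phi u` for `r > 0` and `‖u‖ = 1`,
with scalar multiplication in the fibres. -/
def PhiExt (u : ℍ) : ℍ × ℍ := ((‖u‖ ^ 2)⁻¹ • (star u * qi * u), star u * qk * u)

/-- The ellipsoid embedding, rotated by `rot θ` and followed by `PhiExt`. -/
def coverDef (θ ε : ℝ) (u : ℍ) : ℍ × ℍ :=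
  PhiExt (rot θ * ellipsoid ε (star (rot θ) * u))

/-! ### Finsler metrics on the `2`-sphere -/

/-- `G x v` is a Finsler metric on the `2`-sphere (not necessarily reversible).  Only the values
of `G` on tangent vectors of the sphere matter; smoothness on the slit tangent bundle is
expressed by smoothness of `G` on a neighbourhood. -/
structure IsFinsler (G : ℍ → ℍ → ℝ) : Prop where
  smooth : SmoothNear {p : ℍ × ℍ | p.1 ∈ S2 ∧ p.2 ∈ TS2 p.1 ∧ p.2 ≠ 0} (fun p => G p.1 p.2)
  pos : ∀ x ∈ S2, ∀ v ∈ TS2 x, v ≠ 0 → 0 < G x v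
  homogeneous : ∀ x ∈ S2, ∀ v ∈ TS2 x, ∀ c : ℝ, 0 ≤ c → G x (c • v) = c * G x v
  convex : ∀ x ∈ S2, ∀ v ∈ TS2 x, v ≠ 0 → ∀ w ∈ TS2 x, w ≠ 0 →
    0 < iteratedDeriv 2 (fun s : ℝ => G x (v + s • w) ^ 2 / 2) 0

/-- `G` is a Randers metric: the norm of a Riemannian metric plus a `1`-form `μ`.  The Riemannian
metric is `⟪h x v, w⟫` for tangent vectors `v`, `w` of the sphere at `x`. -/
def IsRanders (G : ℍ → ℍ → ℝ) : Prop :=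
  ∃ (h : ℍ → ℍ →L[ℝ] ℍ) (μ : ℍ → ℍ →L[ℝ] ℝ),
    SmoothNear S2 h ∧ SmoothNear S2 μ ∧ ∀ x ∈ S2,
      (∀ v ∈ TS2 x, ∀ w ∈ TS2 x, ⟪h x v, w⟫ = ⟪h x w, v⟫) ∧
      (∀ v ∈ TS2 x, v ≠ 0 → 0 < ⟪h x v, v⟫) ∧
      ∀ v ∈ TS2 x, G x v = √⟪h x v, v⟫ + μ x v

/-- `γ` is a geodesic of `G`: a regular curve on the sphere that satisfies the Euler-Lagrange
equation of the energy `½ G²`, that is, `d/dt ∂_v(½ G²) - ∂_x(½ G²)` vanishes on the tangent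
planes of the sphere.  (This does not depend on the values of `G` off the tangent bundle.) -/
def IsGeodesic (G : ℍ → ℍ → ℝ) (γ : ℝ → ℍ) : Prop :=
  ContDiff ℝ ∞ γ ∧ (∀ t, γ t ∈ S2) ∧ (∀ t, deriv γ t ≠ 0) ∧
  ∀ t, ∀ w ∈ TS2 (γ t),
    HasDerivAt (fun s : ℝ => fderiv ℝ (fun v => G (γ s) v ^ 2 / 2) (deriv γ s) w)
      (fderiv ℝ (fun x => G x (deriv γ t) ^ 2 / 2) (γ t) w) t

/-- The covector `⟪y, ·⟫` at `x` is the Legendre transform of the tangent vector `v`. -/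
def IsLegendre (G : ℍ → ℍ → ℝ) (x v y : ℍ) : Prop :=
  ∀ w ∈ TS2 x, ⟪y, w⟫ = fderiv ℝ (fun v' => G x v' ^ 2 / 2) v w

/-- The flow `ψ` on a set `N` of covectors is the geodesic flow of `G` on its unit tangent
bundle, when `(x, y)` in `N` is identified with the unit tangent vector whose Legendre transform
is the covector `κ • y`. -/
def IsGeodesicFlow (G : ℍ → ℍ → ℝ) (κ : ℝ) (N : Set (ℍ × ℍ)) (ψ : Flow ℝ N) : Prop :=
  (∀ p : N, ∃ γ : ℝ → ℍ, IsGeodesic G γ ∧ ∀ t,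
    G (γ t) (deriv γ t) = 1 ∧ (ψ t p : ℍ × ℍ).1 = γ t ∧
      IsLegendre G (γ t) (deriv γ t) (κ • (ψ t p : ℍ × ℍ).2)) ∧
  ∀ x ∈ S2, ∀ v ∈ TS2 x, G x v = 1 → ∃ p : N, (p : ℍ × ℍ).1 = x ∧
    IsLegendre G x v (κ • (p : ℍ × ℍ).2)

end QuatMagnetic

end

open QuatMagnetic

noncomputable section

namespace QuatMagnetic

/-! ### Free involutions and flows on quotients -/

/-! Everything is lifted along `PhiExt` to the nonzero quaternions, where it becomes linear. Two
computations carry the proof. By `omegaTheta_PhiExt` the form `ω^θ` pulls back to the constant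
symplectic form `-4 ⟪v, axis θ * w⟫`, where `axis θ` is a unit imaginary quaternion. By `ham_PhiExt`
the Hamiltonian `H^θ_ε` pulls back to the quadratic form `quadHam ε`, rotated by `rot θ`. The lifted
Hamiltonian flow is therefore linear: up to the rotation it turns `z₀` and `z₁` with the speeds `(1
+ ε) / 2` and `(1 - ε) / 2` (`isHamiltonianVector_ham`). The same linear vector field, restricted to
the sphere, is the Reeb field of `α^θ_ε` (`isReebVector_alphaThetaDef`).

The rotated ellipsoid map takes the sphere onto the lifted level set and commutes with the linear
flow, since it is diagonal in `z₀`, `z₁`. As `PhiExt` is a surjective immersion with fibres `{u,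
-u}`, composing the two gives the double cover of (i). The flow downstairs is constructed by
descent, because the linear flow commutes with the sign, and is then recognised as the Hamiltonian
flow. For `ε = 0` the same argument runs on the unit cotangent bundle with `Phi`.

For (ii), a closed orbit downstairs with `z₀` and `z₁` both nonzero would force two integers `m`,
`n` with `ε (m + n) = m - n`; only the two coordinate circles survive when `ε` is irrational.

For (iii), `cos θ = 0` turns `ω^θ` into `±dλ` and the Hamiltonian into the Euclidean norm plus the
evaluation on a Killing field of length less than one. This is the dual norm of the Zermelo metric
obtained by translating the round unit circles by that wind. Hamilton's equations then become the
Euler-Lagrange equation through the Legendre transform. -/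

theorem isCoveringMap_of_involution {X Y : Type*} [TopologicalSpace X] [TopologicalSpace Y]
    [CompactSpace X] [T2Space X] [T2Space Y] {f : X → Y} (hf : Continuous f)
    (hs : Function.Surjective f) {σ : X → X} (hσ : Continuous σ) (hinv : ∀ x, σ (σ x) = x)
    (hfree : ∀ x, σ x ≠ x) (hfib : ∀ x y, f x = f y ↔ x = y ∨ x = σ y) :
    IsCoveringMap f := by
  -- A fixed-point-free involution is a free action of the two-element group `ℤˣ`. The group is
  -- finite, so the action is properly discontinuous, and its orbit map is a covering.
  let act : MulAction ℤˣ X :=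
    { smul := fun g x => if g = 1 then x else σ x
      one_smul := fun x => if_pos rfl
      mul_smul := fun g h x => by
        change (if g * h = 1 then x else σ x) =
          if g = 1 then (if h = 1 then x else σ x) else σ (if h = 1 then x else σ x)
        rcases Int.units_eq_one_or g with rfl | rfl <;>
          rcases Int.units_eq_one_or h with rfl | rfl <;> simp [hinv] }
  have h1 : ∀ x : X, (1 : ℤˣ) • x = x := fun x => if_pos rfl
  have hm1 : ∀ x : X, (-1 : ℤˣ) • x = σ x := fun x => if_neg (by decide)
  have : ContinuousConstSMul ℤˣ X := ⟨fun g => by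
    rcases Int.units_eq_one_or g with rfl | rfl
    · simpa only [h1] using continuous_id'
    · simpa only [hm1] using hσ⟩
  have : IsCancelSMul ℤˣ X := isCancelSMul_iff_eq_one_of_smul_eq.mpr fun g x h => by
    rcases Int.units_eq_one_or g with rfl | rfl
    · rfl
    · exact absurd ((hm1 x).symm.trans h) (hfree x)
  -- A continuous surjection from a compact space onto a Hausdorff space is closed, hence a quotient
  -- map.
  have hq : Topology.IsQuotientMap f := hf.isClosedMap.isQuotientMap hf hs
  refine (hq.isQuotientCoveringMap_of_properlyDiscontinuousSMul (G := ℤˣ) ?_).isCoveringMap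
  intro x y
  rw [hfib, MulAction.mem_orbit_iff]
  constructor
  · rintro (rfl | rfl)
    · exact ⟨1, h1 _⟩
    · exact ⟨-1, hm1 _⟩
  · rintro ⟨g, rfl⟩
    rcases Int.units_eq_one_or g with rfl | rfl
    · exact Or.inl (h1 _)
    · exact Or.inr (hm1 _)

/-- Openness serves joint continuity: the product of the identity of `ℝ` with an open quotient map
is again a quotient map, so continuity of the descended flow can be tested upstairs. -/
theorem exists_flow_of_isOpenQuotientMap {X Y : Type*} [TopologicalSpace X] [TopologicalSpace Y]
    {f : X → Y} (hf : IsOpenQuotientMap f) (φ : Flow ℝ X)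
    (h : ∀ t x y, f x = f y → f (φ t x) = f (φ t y)) :
    ∃ ψ : Flow ℝ Y, ∀ t x, ψ t (f x) = f (φ t x) := by
  have key : ∀ t x, f (φ t (Function.surjInv hf.surjective (f x))) = f (φ t x) := fun t x =>
    h t _ _ (Function.surjInv_eq hf.surjective _)
  refine ⟨⟨fun t y => f (φ t (Function.surjInv hf.surjective y)), ?_, ?_, ?_⟩, key⟩
  · have hq := (IsOpenQuotientMap.id (X := ℝ)).prodMap hf
    refine hq.isQuotientMap.continuous_iff.mpr ?_
    have : Continuous fun p : ℝ × X => f (φ p.1 p.2) := hf.continuous.comp (by fun_prop)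
    refine this.congr fun p => ?_
    exact (key p.1 p.2).symm
  · intro s t y
    obtain ⟨x, rfl⟩ := hf.surjective y
    rw [key, key, ← φ.map_add, key]
  · intro y
    obtain ⟨x, rfl⟩ := hf.surjective y
    rw [key, φ.map_zero_apply]

/-! ### The exterior derivative of a `1`-form -/

theorem dForm_eq {E : Type*} [NormedAddCommGroup E] [NormedSpace ℝ E] {β : E → E →L[ℝ] ℝ}
    {β' : E →L[ℝ] E →L[ℝ] ℝ} {p : E} (h : HasFDerivAt β β' p) (v w : E) :
    dForm β p v w = β' v w - β' w v := by
  let L : (E →L[ℝ] ℝ) →L[ℝ] (E [⋀^Fin 1]→L[ℝ] ℝ) :=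
    (ContinuousAlternatingMap.ofSubsingletonLIE (𝕜 := ℝ) (E := E) (F := ℝ)
      (0 : Fin 1)).toLinearIsometry.toContinuousLinearMap
  have h2 : HasFDerivAt (fun q => ContinuousAlternatingMap.ofSubsingleton ℝ E ℝ (0 : Fin 1) (β q))
      (L.comp β') p := L.hasFDerivAt.comp p h
  rw [dForm, extDeriv, h2.fderiv, ContinuousAlternatingMap.alternatizeUncurryFin_apply]
  have hL : ∀ (g : E →L[ℝ] ℝ) (m : Fin 1 → E), L g m = g (m 0) := fun _ _ => rfl
  simp [Fin.sum_univ_two, hL, Fin.removeNth, sub_eq_add_neg]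

/-! ### Quaternions in coordinates -/

theorem inner_coord (a b : ℍ) :
    ⟪a, b⟫ = a.re * b.re + a.imI * b.imI + a.imJ * b.imJ + a.imK * b.imK := by
  rw [Quaternion.inner_def]
  simp

theorem norm_sq_coord (a : ℍ) :
    ‖a‖ ^ 2 = a.re ^ 2 + a.imI ^ 2 + a.imJ ^ 2 + a.imK ^ 2 := by
  rw [← real_inner_self_eq_norm_sq, inner_coord]
  ring

@[simp] theorem qi_re : qi.re = 0 := rfl
@[simp] theorem qi_imI : qi.imI = 1 := rfl
@[simp] theorem qi_imJ : qi.imJ = 0 := rfl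
@[simp] theorem qi_imK : qi.imK = 0 := rfl
@[simp] theorem qj_re : qj.re = 0 := rfl
@[simp] theorem qj_imI : qj.imI = 0 := rfl
@[simp] theorem qj_imJ : qj.imJ = 1 := rfl
@[simp] theorem qj_imK : qj.imK = 0 := rfl
@[simp] theorem qk_re : qk.re = 0 := rfl
@[simp] theorem qk_imI : qk.imI = 0 := rfl
@[simp] theorem qk_imJ : qk.imJ = 0 := rfl
@[simp] theorem qk_imK : qk.imK = 1 := rfl

theorem re_eq_inner (q : ℍ) : q.re = ⟪(1 : ℍ), q⟫ := by simp [inner_coord]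
theorem imI_eq_inner (q : ℍ) : q.imI = ⟪qi, q⟫ := by simp [inner_coord]
theorem imJ_eq_inner (q : ℍ) : q.imJ = ⟪qj, q⟫ := by simp [inner_coord]
theorem imK_eq_inner (q : ℍ) : q.imK = ⟪qk, q⟫ := by simp [inner_coord]

/-- The quaternion with the given components. -/
def quat (a b c d : ℝ) : ℍ := ⟨a, b, c, d⟩

@[simp] theorem quat_re (a b c d : ℝ) : (quat a b c d).re = a := rfl
@[simp] theorem quat_imI (a b c d : ℝ) : (quat a b c d).imI = b := rfl
@[simp] theorem quat_imJ (a b c d : ℝ) : (quat a b c d).imJ = c := rfl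
@[simp] theorem quat_imK (a b c d : ℝ) : (quat a b c d).imK = d := rfl

theorem quat_eq_sum (a b c d : ℝ) :
    quat a b c d = a • (1 : ℍ) + b • qi + c • qj + d • qk := by
  ext <;> simp

theorem hasDerivAt_quat {a b c d : ℝ → ℝ} {a' b' c' d' t : ℝ} (ha : HasDerivAt a a' t)
    (hb : HasDerivAt b b' t) (hc : HasDerivAt c c' t) (hd : HasDerivAt d d' t) :
    HasDerivAt (fun s => quat (a s) (b s) (c s) (d s)) (quat a' b' c' d') t := by
  simp only [quat_eq_sum]
  exact (((ha.smul_const _).add (hb.smul_const _)).add (hc.smul_const _)).add (hd.smul_const _)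

@[fun_prop]
theorem contDiffAt_quat {E : Type*} [NormedAddCommGroup E] [NormedSpace ℝ E] {n : WithTop ℕ∞}
    {a b c d : E → ℝ} {p : E} (ha : ContDiffAt ℝ n a p)
    (hb : ContDiffAt ℝ n b p) (hc : ContDiffAt ℝ n c p) (hd : ContDiffAt ℝ n d p) :
    ContDiffAt ℝ n (fun s => quat (a s) (b s) (c s) (d s)) p := by
  simp only [quat_eq_sum]
  exact (((ha.smul contDiffAt_const).add (hb.smul contDiffAt_const)).add
    (hc.smul contDiffAt_const)).add (hd.smul contDiffAt_const)

@[fun_prop]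
theorem continuous_quat {X : Type*} [TopologicalSpace X] {a b c d : X → ℝ} (ha : Continuous a)
    (hb : Continuous b) (hc : Continuous c) (hd : Continuous d) :
    Continuous (fun s => quat (a s) (b s) (c s) (d s)) := by
  simp only [quat_eq_sum]
  fun_prop

@[fun_prop]
theorem contDiff_re {n : WithTop ℕ∞} : ContDiff ℝ n fun q : ℍ => q.re := by
  simpa only [re_eq_inner] using! (innerSL ℝ (1 : ℍ)).contDiff
@[fun_prop]
theorem contDiff_imI {n : WithTop ℕ∞} : ContDiff ℝ n fun q : ℍ => q.imI := by
  simpa only [imI_eq_inner] using! (innerSL ℝ qi).contDiff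
@[fun_prop]
theorem contDiff_imJ {n : WithTop ℕ∞} : ContDiff ℝ n fun q : ℍ => q.imJ := by
  simpa only [imJ_eq_inner] using! (innerSL ℝ qj).contDiff
@[fun_prop]
theorem contDiff_imK {n : WithTop ℕ∞} : ContDiff ℝ n fun q : ℍ => q.imK := by
  simpa only [imK_eq_inner] using! (innerSL ℝ qk).contDiff

theorem star_mul_inner (a u v : ℍ) : ⟪star a * u, v⟫ = ⟪u, a * v⟫ := by
  simp only [inner_coord, Quaternion.re_mul, Quaternion.imI_mul, Quaternion.imJ_mul,
    Quaternion.imK_mul, Quaternion.re_star, Quaternion.imI_star, Quaternion.imJ_star,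
    Quaternion.imK_star]
  ring

@[fun_prop]
theorem contDiff_star {n : WithTop ℕ∞} : ContDiff ℝ n (fun q : ℍ => star q) := by
  have h : ∀ q : ℍ, star q = (2 * q.re) • (1 : ℍ) - q := fun q => by
    ext <;> simp; ring
  simp only [h]
  fun_prop

/-! ### Rotations of the sphere -/

@[simp] theorem rot_re (θ : ℝ) : (rot θ).re = cos (θ / 2) := rfl
@[simp] theorem rot_imI (θ : ℝ) : (rot θ).imI = 0 := rfl
@[simp] theorem rot_imJ (θ : ℝ) : (rot θ).imJ = 0 := rfl
@[simp] theorem rot_imK (θ : ℝ) : (rot θ).imK = sin (θ / 2) := rfl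

theorem rot_mul_star_self (θ : ℝ) : rot θ * star (rot θ) = 1 := by
  have h := sin_sq_add_cos_sq (θ / 2)
  ext <;> simp
  · linear_combination h
  · ring

theorem star_rot_mul_self (θ : ℝ) : star (rot θ) * rot θ = 1 := by
  have h := sin_sq_add_cos_sq (θ / 2)
  ext <;> simp
  · linear_combination h
  · ring

theorem rot_mul_cancel (θ : ℝ) (u : ℍ) : rot θ * (star (rot θ) * u) = u := by
  rw [← mul_assoc, rot_mul_star_self, one_mul]

theorem star_rot_mul_cancel (θ : ℝ) (u : ℍ) : star (rot θ) * (rot θ * u) = u := by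
  rw [← mul_assoc, star_rot_mul_self, one_mul]

theorem norm_rot (θ : ℝ) : ‖rot θ‖ = 1 := by
  have h : ‖rot θ‖ ^ 2 = 1 := by
    rw [norm_sq_coord]
    simp
  exact (pow_eq_one_iff_of_nonneg (norm_nonneg _) two_ne_zero).mp h

theorem norm_rot_mul (θ : ℝ) (u : ℍ) : ‖rot θ * u‖ = ‖u‖ := by
  rw [norm_mul, norm_rot, one_mul]

theorem norm_star_rot_mul (θ : ℝ) (u : ℍ) : ‖star (rot θ) * u‖ = ‖u‖ := by
  rw [norm_mul, Quaternion.norm_star, norm_rot, one_mul]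

theorem inner_star_rot_mul (θ : ℝ) (u v : ℍ) : ⟪star (rot θ) * u, star (rot θ) * v⟫ = ⟪u, v⟫ := by
  rw [star_mul_inner, rot_mul_cancel]

theorem inner_rot_mul (θ : ℝ) (u v : ℍ) : ⟪rot θ * u, rot θ * v⟫ = ⟪u, v⟫ := by
  rw [← star_mul_inner, star_rot_mul_cancel]

theorem rot_zero : rot 0 = 1 := by
  ext <;> simp

theorem rot_add (θ θ' : ℝ) : rot (θ + θ') = rot θ * rot θ' := by
  ext <;> simp [add_div, cos_add, sin_add] <;> ring

theorem rot_two_pi : rot (2 * π) = -1 := by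
  ext <;> simp

theorem rot_add_two_pi (θ : ℝ) : rot (θ + 2 * π) = -rot θ := by
  rw [rot_add, rot_two_pi, mul_neg_one]

theorem rot_add_four_pi (θ : ℝ) : rot (θ + 4 * π) = rot θ := by
  rw [show θ + 4 * π = θ + 2 * π + 2 * π by ring, rot_add_two_pi, rot_add_two_pi, neg_neg]

/-- `cos θ i + sin θ j`. -/
def axis (θ : ℝ) : ℍ := quat 0 (cos θ) (sin θ) 0

/-- Conjugation by `cos (θ/2) + sin (θ/2) k` rotates the plane of `i` and `j` by the angle `θ`. This
is why half-angles occur in `rot`, and it is the source of every `θ`-dependence below. -/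
theorem rot_mul_qi_mul_star (θ : ℝ) : rot θ * qi * star (rot θ) = axis θ := by
  have hc : cos θ = cos (θ / 2) ^ 2 - sin (θ / 2) ^ 2 := by
    rw [← cos_two_mul']; congr 1; ring
  have hs : sin θ = 2 * sin (θ / 2) * cos (θ / 2) := by
    rw [← sin_two_mul]; congr 1; ring
  ext <;> simp [axis, hc, hs] <;> ring

/-! ### Linear `1`-forms -/

theorem hasFDerivAt_innerSL_comp {E F : Type*} [NormedAddCommGroup E] [NormedSpace ℝ E]
    [NormedAddCommGroup F] [InnerProductSpace ℝ F] {f : E → F} {f' : E →L[ℝ] F} {p : E}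
    (h : HasFDerivAt f f' p) :
    HasFDerivAt (fun q => innerSL ℝ (f q)) ((innerSL ℝ : F →L[ℝ] F →L[ℝ] ℝ).comp f') p :=
  (innerSL ℝ : F →L[ℝ] F →L[ℝ] ℝ).hasFDerivAt.comp p h

theorem dForm_innerSL (B : ℍ →L[ℝ] ℍ) (p v w : ℍ) :
    dForm (fun u => innerSL ℝ (B u)) p v w = ⟪B v, w⟫ - ⟪B w, v⟫ := by
  rw [dForm_eq (hasFDerivAt_innerSL_comp B.hasFDerivAt)]
  rfl

/-- The skew operator `A` with `alphaDef ε u = ⟪A u, ·⟫`. -/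
def skewOp (ε : ℝ) : ℍ →L[ℝ] ℍ :=
  LinearMap.toContinuousLinearMap
    { toFun := fun u => quat (-(2 / (1 + ε) * u.imI)) (2 / (1 + ε) * u.re)
        (-(2 / (1 - ε) * u.imK)) (2 / (1 - ε) * u.imJ)
      map_add' := fun u v => by ext <;> simp <;> ring
      map_smul' := fun c u => by ext <;> simp <;> ring }

theorem skewOp_apply (ε : ℝ) (u : ℍ) : skewOp ε u = quat (-(2 / (1 + ε) * u.imI))
    (2 / (1 + ε) * u.re) (-(2 / (1 - ε) * u.imK)) (2 / (1 - ε) * u.imJ) := rfl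

theorem alphaDef_eq (ε : ℝ) : alphaDef ε = fun u => innerSL ℝ (skewOp ε u) := rfl

theorem alphaThetaDef_apply (θ ε : ℝ) (u v : ℍ) :
    alphaThetaDef θ ε u v = ⟪skewOp ε (star (rot θ) * u), star (rot θ) * v⟫ := by
  have h : HasFDerivAt (fun u => star (rot θ) * u)
      (ContinuousLinearMap.mul ℝ ℍ (star (rot θ))) u :=
    (ContinuousLinearMap.mul ℝ ℍ (star (rot θ))).hasFDerivAt
  rw [alphaThetaDef, pushRot, pullback, h.fderiv, alphaDef_eq]
  rfl

theorem inner_star_rot_mul_right (θ : ℝ) (u v : ℍ) : ⟪u, star (rot θ) * v⟫ = ⟪rot θ * u, v⟫ := by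
  rw [← inner_rot_mul θ, rot_mul_cancel]

theorem alphaThetaDef_eq (θ ε : ℝ) : alphaThetaDef θ ε =
    fun u => innerSL ℝ (((ContinuousLinearMap.mul ℝ ℍ (rot θ)).comp ((skewOp ε).comp
      (ContinuousLinearMap.mul ℝ ℍ (star (rot θ))))) u) := by
  funext u
  ext v
  rw [alphaThetaDef_apply, inner_star_rot_mul_right]
  rfl

theorem dForm_alphaThetaDef (θ ε : ℝ) (p v w : ℍ) : dForm (alphaThetaDef θ ε) p v w =
    2 * ⟪skewOp ε (star (rot θ) * v), star (rot θ) * w⟫ := by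
  rw [alphaThetaDef_eq, dForm_innerSL]
  simp only [ContinuousLinearMap.comp_apply, ContinuousLinearMap.mul_apply',
    ← inner_star_rot_mul_right]
  generalize star (rot θ) * v = v
  generalize star (rot θ) * w = w
  simp [inner_coord, skewOp_apply]
  ring

theorem smoothNear_alphaThetaDef (θ ε : ℝ) : SmoothNear S3 (alphaThetaDef θ ε) := by
  refine ⟨univ, isOpen_univ, subset_univ _, ?_⟩
  rw [alphaThetaDef_eq]
  exact ((innerSL ℝ : ℍ →L[ℝ] ℍ →L[ℝ] ℝ).contDiff.comp (ContinuousLinearMap.contDiff _)).contDiffOn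

theorem isContactForm_alphaThetaDef (θ : ℝ) {ε : ℝ} (hε : ε ∈ Ico (0 : ℝ) 1) :
    IsContactForm S3 TS3 (alphaThetaDef θ ε) := by
  refine ⟨smoothNear_alphaThetaDef θ ε, fun p hp => ?_⟩
  have hp' : ‖star (rot θ) * p‖ ^ 2 = 1 := by
    rw [norm_star_rot_mul, show ‖p‖ = 1 from hp, one_pow]
  have hT : ∀ c : ℍ, c.re = 0 → rot θ * (c * (star (rot θ) * p)) ∈ TS3 p := fun c hc => by
    change ⟪p, _⟫ = 0
    rw [← star_mul_inner]
    generalize star (rot θ) * p = w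
    simp [inner_coord, hc]
    ring
  -- With `w = star (rot θ) * p`, the frame `i w, j w, k w`, rotated back by `rot θ`, spans the
  -- tangent space at `p`. In it the `3`-form equals a positive constant times `‖w‖ ^ 4`.
  refine ⟨_, hT qi rfl, _, hT qj rfl, _, hT qk rfl, ?_⟩
  simp only [wedgeD, alphaThetaDef_apply, dForm_alphaThetaDef, star_rot_mul_cancel]
  generalize star (rot θ) * p = w at hp'
  rw [norm_sq_coord] at hp'
  have h1 : (1 + ε) ≠ 0 := by linarith [hε.1]
  have h2 : (1 - ε) ≠ 0 := by linarith [hε.2]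
  have : ⟪skewOp ε w, qi * w⟫ * (2 * ⟪skewOp ε (qj * w), qk * w⟫) +
      ⟪skewOp ε w, qj * w⟫ * (2 * ⟪skewOp ε (qk * w), qi * w⟫) +
      ⟪skewOp ε w, qk * w⟫ * (2 * ⟪skewOp ε (qi * w), qj * w⟫) =
      2 * (2 / (1 + ε)) * (2 / (1 - ε)) * (w.re ^ 2 + w.imI ^ 2 + w.imJ ^ 2 + w.imK ^ 2) ^ 2 := by
    simp only [skewOp_apply]
    generalize 2 / (1 + ε) = a
    generalize 2 / (1 - ε) = b
    simp [inner_coord]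
    ring
  rw [this, hp']
  positivity

theorem pushRot_alpha_qi (θ : ℝ) : pushRot θ (alpha qi) = alphaTheta θ := by
  funext u
  have h : HasFDerivAt (fun u => star (rot θ) * u)
      (ContinuousLinearMap.mul ℝ ℍ (star (rot θ))) u :=
    (ContinuousLinearMap.mul ℝ ℍ (star (rot θ))).hasFDerivAt
  ext v
  rw [pushRot, pullback, h.fderiv]
  change -2 * ⟪star (rot θ) * u, qi * (star (rot θ) * v)⟫ =
    cos θ * (-2 * ⟪u, qi * v⟫) + sin θ * (-2 * ⟪u, qj * v⟫)
  rw [star_mul_inner, ← mul_assoc, ← mul_assoc, rot_mul_qi_mul_star]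
  simp [inner_coord, axis]
  ring

theorem alphaDef_zero : alphaDef 0 = alpha qi := by
  funext u
  ext v
  change ⟪skewOp 0 u, v⟫ = -2 * ⟪u, qi * v⟫
  simp [inner_coord, skewOp_apply]
  ring

theorem alphaThetaDef_zero_right (θ : ℝ) : alphaThetaDef θ 0 = alphaTheta θ := by
  rw [alphaThetaDef, alphaDef_zero, pushRot_alpha_qi]

theorem alphaTheta_zero : alphaTheta 0 = alpha qi := by
  funext u
  simp [alphaTheta]

theorem alphaTheta_pi_div_two : alphaTheta (π / 2) = alpha qj := by
  funext u
  simp [alphaTheta]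

theorem alphaThetaDef_zero_left (ε : ℝ) : alphaThetaDef 0 ε = alphaDef ε := by
  funext u
  ext v
  rw [alphaThetaDef_apply, rot_zero, star_one, one_mul, one_mul]
  rfl

theorem isContactForm_alphaTheta (θ : ℝ) : IsContactForm S3 TS3 (alphaTheta θ) := by
  rw [← alphaThetaDef_zero_right]
  exact isContactForm_alphaThetaDef θ ⟨le_rfl, one_pos⟩

/-- The rotation changes only by a sign, and the form is even in it because its coefficients are
linear. -/
theorem alphaThetaDef_add_two_pi (θ ε : ℝ) (u v : ℍ) :
    alphaThetaDef (θ + 2 * π) ε u v = alphaThetaDef θ ε u v := by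
  simp [alphaThetaDef_apply, rot_add_two_pi]

theorem contDiffOn_alphaDef :
    ContDiffOn ℝ ∞ (fun q : ℝ × ℍ => alphaDef q.1 q.2) (Ico 0 1 ×ˢ univ) := by
  intro q hq
  have h1 : (1 + q.1) ≠ 0 := by linarith [hq.1.1]
  have h2 : (1 - q.1) ≠ 0 := by linarith [hq.1.2]
  refine ContDiffAt.contDiffWithinAt ?_
  refine ((innerSL ℝ : ℍ →L[ℝ] ℍ →L[ℝ] ℝ).contDiff.contDiffAt).comp q (contDiffAt_quat ?_ ?_ ?_ ?_)
  all_goals fun_prop (disch := assumption)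

/-! ### The Reeb flows -/

/-- The linear vector field generating the Reeb flow of `alphaDef ε`. -/
def reebOp (ε : ℝ) (u : ℍ) : ℍ :=
  quat (-((1 + ε) / 2 * u.imI)) ((1 + ε) / 2 * u.re) (-((1 - ε) / 2 * u.imK)) ((1 - ε) / 2 * u.imJ)

theorem isReebVector_alphaThetaDef (θ : ℝ) {ε : ℝ} (hε : ε ∈ Ico (0 : ℝ) 1) {p : ℍ}
    (hp : p ∈ S3) :
    IsReebVector TS3 (alphaThetaDef θ ε) p (rot θ * reebOp ε (star (rot θ) * p)) := by
  have h1 : (1 + ε) ≠ 0 := by linarith [hε.1]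
  have h2 : (1 - ε) ≠ 0 := by linarith [hε.2]
  have h3 : 2 / (1 + ε) * ((1 + ε) / 2) = 1 := by field_simp
  have h4 : 2 / (1 - ε) * ((1 - ε) / 2) = 1 := by field_simp
  -- The Reeb operator inverts the skew operator up to sign. Hence `dβ(R, w) = -2 ⟪p, w⟫`, which
  -- vanishes on the tangent space of the sphere.
  have hA : skewOp ε (reebOp ε (star (rot θ) * p)) = -(star (rot θ) * p) := by
    generalize star (rot θ) * p = w
    ext <;> simp [skewOp_apply, reebOp, ← mul_assoc, h3, h4]
  refine ⟨?_, ?_, fun w hw => ?_⟩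
  · change ⟪p, _⟫ = 0
    rw [← star_mul_inner]
    generalize star (rot θ) * p = w
    simp [inner_coord, reebOp]
    ring
  · have hp' : ‖star (rot θ) * p‖ ^ 2 = 1 := by
      rw [norm_star_rot_mul, show ‖p‖ = 1 from hp, one_pow]
    rw [alphaThetaDef_apply, star_rot_mul_cancel]
    generalize star (rot θ) * p = w at hp'
    rw [norm_sq_coord] at hp'
    simp only [inner_coord, reebOp, skewOp_apply, quat_re, quat_imI, quat_imJ, quat_imK]
    linear_combination hp' + (w.re ^ 2 + w.imI ^ 2) * h3 + (w.imJ ^ 2 + w.imK ^ 2) * h4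
  · rw [dForm_alphaThetaDef, star_rot_mul_cancel, hA, inner_neg_left, inner_star_rot_mul,
      show ⟪p, w⟫ = 0 from hw]
    simp

/-- The flow `(e^{i(1+ε)t/2} z₀, e^{i(1-ε)t/2} z₁)`. -/
def baseFlow (ε t : ℝ) (u : ℍ) : ℍ :=
  quat (cos ((1 + ε) / 2 * t) * u.re - sin ((1 + ε) / 2 * t) * u.imI)
   (sin ((1 + ε) / 2 * t) * u.re + cos ((1 + ε) / 2 * t) * u.imI)
   (cos ((1 - ε) / 2 * t) * u.imJ - sin ((1 - ε) / 2 * t) * u.imK)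
   (sin ((1 - ε) / 2 * t) * u.imJ + cos ((1 - ε) / 2 * t) * u.imK)

theorem baseFlow_add (ε s t : ℝ) (u : ℍ) :
    baseFlow ε (s + t) u = baseFlow ε s (baseFlow ε t u) := by
  ext <;> simp [baseFlow, mul_add, cos_add, sin_add] <;> ring

theorem baseFlow_zero (ε : ℝ) (u : ℍ) : baseFlow ε 0 u = u := by
  ext <;> simp [baseFlow]

theorem baseFlow_neg (ε t : ℝ) (u : ℍ) : baseFlow ε t (-u) = -baseFlow ε t u := by
  ext <;> simp [baseFlow] <;> ring

theorem norm_baseFlow (ε t : ℝ) (u : ℍ) : ‖baseFlow ε t u‖ = ‖u‖ := by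
  rw [← sq_eq_sq₀ (norm_nonneg _) (norm_nonneg _), norm_sq_coord, norm_sq_coord]
  simp only [baseFlow, quat_re, quat_imI, quat_imJ, quat_imK]
  have h1 := sin_sq_add_cos_sq ((1 + ε) / 2 * t)
  have h2 := sin_sq_add_cos_sq ((1 - ε) / 2 * t)
  linear_combination (u.re ^ 2 + u.imI ^ 2) * h1 + (u.imJ ^ 2 + u.imK ^ 2) * h2

theorem hasDerivAt_baseFlow (ε t : ℝ) (u : ℍ) :
    HasDerivAt (fun s => baseFlow ε s u) (reebOp ε (baseFlow ε t u)) t := by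
  have hc : ∀ a : ℝ, HasDerivAt (fun s => cos (a * s)) (-sin (a * t) * a) t := fun a => by
    simpa using ((hasDerivAt_id t).const_mul a).cos
  have hs : ∀ a : ℝ, HasDerivAt (fun s => sin (a * s)) (cos (a * t) * a) t := fun a => by
    simpa using ((hasDerivAt_id t).const_mul a).sin
  have := hasDerivAt_quat
    (((hc ((1 + ε) / 2)).mul_const u.re).sub ((hs ((1 + ε) / 2)).mul_const u.imI))
    (((hs ((1 + ε) / 2)).mul_const u.re).add ((hc ((1 + ε) / 2)).mul_const u.imI))
    (((hc ((1 - ε) / 2)).mul_const u.imJ).sub ((hs ((1 - ε) / 2)).mul_const u.imK))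
    (((hs ((1 - ε) / 2)).mul_const u.imJ).add ((hc ((1 - ε) / 2)).mul_const u.imK))
  refine this.congr_deriv ?_
  ext <;> simp [reebOp, baseFlow] <;> ring

theorem continuous_baseFlow (ε : ℝ) : Continuous fun q : ℝ × ℍ => baseFlow ε q.1 q.2 := by
  have h0 := Quaternion.continuous_re
  have h1 := Quaternion.continuous_imI
  have h2 := Quaternion.continuous_imJ
  have h3 := Quaternion.continuous_imK
  refine continuous_quat ?_ ?_ ?_ ?_ <;> fun_prop

/-- The flow `baseFlow`, rotated by `rot θ`. -/
def rotFlow (θ ε t : ℝ) (u : ℍ) : ℍ := rot θ * baseFlow ε t (star (rot θ) * u)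

theorem norm_rotFlow (θ ε t : ℝ) (u : ℍ) : ‖rotFlow θ ε t u‖ = ‖u‖ := by
  rw [rotFlow, norm_rot_mul, norm_baseFlow, norm_star_rot_mul]

theorem star_rot_mul_rotFlow (θ ε t : ℝ) (u : ℍ) :
    star (rot θ) * rotFlow θ ε t u = baseFlow ε t (star (rot θ) * u) := star_rot_mul_cancel _ _

theorem rotFlow_neg (θ ε t : ℝ) (u : ℍ) : rotFlow θ ε t (-u) = -rotFlow θ ε t u := by
  simp [rotFlow, baseFlow_neg]

theorem hasDerivAt_rotFlow (θ ε t : ℝ) (u : ℍ) : HasDerivAt (fun s => rotFlow θ ε s u)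
    (rot θ * reebOp ε (star (rot θ) * rotFlow θ ε t u)) t := by
  rw [star_rot_mul_rotFlow]
  exact (hasDerivAt_baseFlow ε t _).const_mul (rot θ)

theorem rotFlow_mem (θ ε t : ℝ) {u : ℍ} (hu : u ∈ S3) : rotFlow θ ε t u ∈ S3 :=
  (norm_rotFlow θ ε t u).trans hu

theorem rotFlow_add (θ ε s t : ℝ) (u : ℍ) :
    rotFlow θ ε (s + t) u = rotFlow θ ε s (rotFlow θ ε t u) := by
  simp only [rotFlow, baseFlow_add, star_rot_mul_cancel]

theorem rotFlow_zero (θ ε : ℝ) (u : ℍ) : rotFlow θ ε 0 u = u := by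
  simp only [rotFlow, baseFlow_zero, rot_mul_cancel]

theorem continuous_rotFlow (θ ε : ℝ) : Continuous fun q : ℝ × ℍ => rotFlow θ ε q.1 q.2 :=
  continuous_const.mul ((continuous_baseFlow ε).comp
    (continuous_fst.prodMk (continuous_const.mul continuous_snd)))

/-- The Reeb flow of `alphaThetaDef θ ε` on the sphere. -/
def reebFlow (θ ε : ℝ) : Flow ℝ S3 where
  toFun t u := ⟨rotFlow θ ε t u, rotFlow_mem θ ε t u.2⟩
  cont' := Continuous.subtype_mk ((continuous_rotFlow θ ε).comp
    (continuous_fst.prodMk (continuous_subtype_val.comp continuous_snd))) _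
  map_add' s t u := Subtype.ext (rotFlow_add θ ε s t u)
  map_zero' u := Subtype.ext (rotFlow_zero θ ε u)

theorem coe_reebFlow (θ ε t : ℝ) (u : S3) : (reebFlow θ ε t u : ℍ) = rotFlow θ ε t u := rfl

theorem isReebFlow_reebFlow (θ : ℝ) {ε : ℝ} (hε : ε ∈ Ico (0 : ℝ) 1) :
    IsReebFlow S3 TS3 (alphaThetaDef θ ε) (reebFlow θ ε) := fun u t =>
  ⟨_, hasDerivAt_rotFlow θ ε t u, isReebVector_alphaThetaDef θ hε (reebFlow θ ε t u).2⟩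

theorem reebFlow_four_pi (θ : ℝ) (u : S3) : reebFlow θ 0 (4 * π) u = u ∧
    ∀ t, 0 < t → t < 4 * π → reebFlow θ 0 t u ≠ u := by
  -- For `ε = 0` both speeds are `1/2`, so the flow is left multiplication by `e^{it/2}`; it fixes a
  -- nonzero quaternion only if `e^{it/2} = 1`.
  have key : ∀ t, baseFlow 0 t (star (rot θ) * u) =
      quat (cos (t / 2)) (sin (t / 2)) 0 0 * (star (rot θ) * u) := fun t => by
    have h : 2⁻¹ * t = t / 2 := by ring
    ext <;> simp [baseFlow, h] <;> ring
  constructor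
  · refine Subtype.ext ?_
    rw [coe_reebFlow, rotFlow, key, show 4 * π / 2 = 2 * π by ring, cos_two_pi, sin_two_pi]
    exact (congrArg _ (one_mul _)).trans (rot_mul_cancel θ u)
  · intro t h0 h1 h
    have h2 := congrArg (fun v : S3 => star (rot θ) * (v : ℍ)) h
    simp only [coe_reebFlow, star_rot_mul_rotFlow, key] at h2
    have h3 : star (rot θ) * (u : ℍ) ≠ 0 := by
      rw [← norm_ne_zero_iff, norm_star_rot_mul, show ‖(u : ℍ)‖ = 1 from u.2]
      exact one_ne_zero
    have h4 := mul_right_cancel₀ h3 (h2.trans (one_mul _).symm)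
    have h5 : cos (t / 2) = 1 := congrArg (fun q : ℍ => q.re) h4
    obtain ⟨n, hn⟩ := (cos_eq_one_iff _).mp h5
    have h6 : (0 : ℝ) < n := by
      by_contra! hc
      nlinarith [pi_pos]
    have h7 : (n : ℝ) < 1 := by
      by_contra! hc
      nlinarith [pi_pos]
    have h8 : (0 : ℤ) < n := by exact_mod_cast h6
    have h9 : n < 1 := by exact_mod_cast h7
    omega

/-! ### Conjugation by a quaternion -/

/-- The linear map `q ↦ ū q u`. -/
def sandwich (u q : ℍ) : ℍ := star u * q * u

theorem star_mul_self_eq (u : ℍ) : star u * u = (‖u‖ ^ 2) • (1 : ℍ) := by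
  rw [norm_sq_coord]
  ext <;> simp <;> ring

theorem mul_star_self_eq (u : ℍ) : u * star u = (‖u‖ ^ 2) • (1 : ℍ) := by
  rw [norm_sq_coord]
  ext <;> simp <;> ring

theorem sandwich_add (u p q : ℍ) : sandwich u (p + q) = sandwich u p + sandwich u q := by
  simp only [sandwich, mul_add, add_mul]

theorem sandwich_smul (u : ℍ) (c : ℝ) (q : ℍ) : sandwich u (c • q) = c • sandwich u q := by
  simp only [sandwich, mul_smul_comm, smul_mul_assoc]

theorem sandwich_sub (u p q : ℍ) : sandwich u (p - q) = sandwich u p - sandwich u q := by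
  simp only [sandwich, mul_sub, sub_mul]

theorem re_sandwich (u q : ℍ) : (sandwich u q).re = ‖u‖ ^ 2 * q.re := by
  rw [norm_sq_coord]
  simp [sandwich]
  ring

theorem inner_sandwich (u p q : ℍ) :
    ⟪sandwich u p, sandwich u q⟫ = (‖u‖ ^ 2) ^ 2 * ⟪p, q⟫ := by
  have h : ∀ a b : ℍ, ⟪a * u, b * u⟫ = ‖u‖ ^ 2 * ⟪a, b⟫ := fun a b => by
    rw [norm_sq_coord]
    simp [inner_coord]
    ring
  have h' : ∀ a b : ℍ, ⟪star u * a, star u * b⟫ = ‖u‖ ^ 2 * ⟪a, b⟫ := fun a b => by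
    rw [norm_sq_coord]
    simp [inner_coord]
    ring
  rw [sandwich, sandwich, h, h']
  ring

theorem norm_sandwich (u q : ℍ) : ‖sandwich u q‖ = ‖u‖ ^ 2 * ‖q‖ := by
  rw [sandwich, norm_mul, norm_mul, Quaternion.norm_star]
  ring

theorem sandwich_mul_sandwich (u p q : ℍ) :
    sandwich u p * sandwich u q = sandwich u (‖u‖ ^ 2 • (p * q)) := by
  rw [sandwich_smul]
  simp only [sandwich]
  rw [show star u * p * u * (star u * q * u) = star u * p * (u * star u) * q * u by
    simp only [mul_assoc], mul_star_self_eq]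
  simp only [mul_smul_comm, smul_mul_assoc, mul_one, mul_assoc]

theorem cross_sandwich (u p q : ℍ) :
    cross (sandwich u p) (sandwich u q) = sandwich u (‖u‖ ^ 2 • cross p q) := by
  simp only [cross, sandwich_mul_sandwich, sandwich_smul, sandwich_sub]
  module

theorem exists_sandwich_eq {u : ℍ} (hu : u ≠ 0) (q : ℍ) : ∃ p, sandwich u p = q := by
  have h : ‖u‖ ^ 2 ≠ 0 := pow_ne_zero 2 (norm_ne_zero_iff.mpr hu)
  refine ⟨((‖u‖ ^ 2)⁻¹ * (‖u‖ ^ 2)⁻¹) • (u * q * star u), ?_⟩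
  rw [sandwich_smul, sandwich,
    show star u * (u * q * star u) * u = (star u * u) * q * (star u * u) by simp only [mul_assoc],
    star_mul_self_eq]
  simp only [smul_mul_assoc, one_mul, mul_smul_comm, mul_one, smul_smul]
  rw [show (‖u‖ ^ 2)⁻¹ * (‖u‖ ^ 2)⁻¹ * (‖u‖ ^ 2 * ‖u‖ ^ 2) = 1 by field_simp, one_smul]

theorem cross_eq (x y : ℍ) : cross x y = quat 0 (x.imJ * y.imK - x.imK * y.imJ)
    (x.imK * y.imI - x.imI * y.imK) (x.imI * y.imJ - x.imJ * y.imI) := by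
  ext <;> simp [cross] <;> ring

/-! ### The exterior derivatives of the `1`-forms on the cotangent bundle -/

theorem hasDerivAt_line {E : Type*} [NormedAddCommGroup E] [NormedSpace ℝ E] (p v : E) :
    HasDerivAt (fun t : ℝ => p + t • v) v 0 := by
  simpa using ((hasDerivAt_id (0 : ℝ)).smul_const v).const_add p

theorem fderiv_eq_of_line {E F : Type*} [NormedAddCommGroup E] [NormedSpace ℝ E]
    [NormedAddCommGroup F] [NormedSpace ℝ F] {f : E → F} {p v : E} {w : F}
    (hf : DifferentiableAt ℝ f p) (h : HasDerivAt (fun t : ℝ => f (p + t • v)) w 0) :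
    fderiv ℝ f p v = w := by
  have h0 : HasFDerivAt f (fderiv ℝ f p) (p + (0 : ℝ) • v) := by
    simpa using hf.hasFDerivAt
  exact (h0.comp_hasDerivAt (0 : ℝ) (hasDerivAt_line p v)).unique h

/-- Evaluating `β` along lines on constant vectors avoids computing the operator-valued derivative
of `β`. -/
theorem dForm_eq_of_line {E : Type*} [NormedAddCommGroup E] [NormedSpace ℝ E]
    {β : E → E →L[ℝ] ℝ} {p : E} (hβ : DifferentiableAt ℝ β p) {b : E → E → ℝ}
    (h : ∀ v w, HasDerivAt (fun t : ℝ => β (p + t • v) w) (b v w) 0) (v w : E) :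
    dForm β p v w = b v w - b w v := by
  have key : ∀ v w, fderiv ℝ β p v w = b v w := fun v w => by
    have h0 : HasFDerivAt β (fderiv ℝ β p) (p + (0 : ℝ) • v) := by
      simpa using hβ.hasFDerivAt
    have h1 := h0.comp_hasDerivAt (0 : ℝ) (hasDerivAt_line p v)
    have h2 := h1.clm_apply (hasDerivAt_const (0 : ℝ) w)
    simp only [map_zero, add_zero] at h2
    exact h2.unique (h v w)
  rw [dForm_eq hβ.hasFDerivAt, key, key]

@[fun_prop]
theorem contDiff_cross {n : WithTop ℕ∞} : ContDiff ℝ n (fun p : ℍ × ℍ => cross p.1 p.2) := by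
  unfold cross
  fun_prop

theorem contDiff_liouville {n : WithTop ℕ∞} : ContDiff ℝ n liouville := by
  have h : ContDiff ℝ n fun p : ℍ × ℍ => innerSL ℝ p.2 :=
    (innerSL ℝ : ℍ →L[ℝ] ℍ →L[ℝ] ℝ).contDiff.comp contDiff_snd
  exact h.clm_comp contDiff_const

theorem contDiffAt_rhoConnection {n : WithTop ℕ∞} {p : ℍ × ℍ} (hp : p.2 ≠ 0) :
    ContDiffAt ℝ n rhoConnection p := by
  have h2 : ContDiffAt ℝ n (fun p : ℍ × ℍ => -‖p.2‖⁻¹ • cross p.1 p.2) p :=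
    ((contDiffAt_snd.norm ℝ hp).inv (norm_ne_zero_iff.mpr hp)).neg.smul contDiff_cross.contDiffAt
  have h : ContDiffAt ℝ n (fun p : ℍ × ℍ => innerSL ℝ (-‖p.2‖⁻¹ • cross p.1 p.2)) p :=
    (innerSL ℝ : ℍ →L[ℝ] ℍ →L[ℝ] ℝ).contDiff.contDiffAt.comp p h2
  refine (h.clm_comp
    (contDiffAt_const (c := ContinuousLinearMap.snd ℝ ℍ ℍ))).congr_of_eventuallyEq (.of_forall fun q => ?_)
  refine ContinuousLinearMap.ext fun v => ?_
  simp [rhoConnection]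

theorem dForm_liouville (p v w : ℍ × ℍ) :
    dForm liouville p v w = ⟪v.2, w.1⟫ - ⟪w.2, v.1⟫ := by
  refine dForm_eq_of_line (b := fun v w => ⟪v.2, w.1⟫)
    (contDiff_liouville.differentiable one_ne_zero p) (fun v w => ?_) v w
  have := (hasDerivAt_line p.2 v.2).inner ℝ (hasDerivAt_const (0 : ℝ) w.1)
  rw [inner_zero_right, zero_add] at this
  exact this

theorem dForm_rhoConnection {p : ℍ × ℍ} (hp : p.2 ≠ 0) (v w : ℍ × ℍ) :
    dForm rhoConnection p v w =
      (⟪p.2, v.2⟫ / ‖p.2‖ ^ 3 * ⟪cross p.1 p.2, w.2⟫ -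
        ‖p.2‖⁻¹ * ⟪cross v.1 p.2 + cross p.1 v.2, w.2⟫) -
      (⟪p.2, w.2⟫ / ‖p.2‖ ^ 3 * ⟪cross p.1 p.2, v.2⟫ -
        ‖p.2‖⁻¹ * ⟪cross w.1 p.2 + cross p.1 w.2, v.2⟫) := by
  refine dForm_eq_of_line (b := fun v w => ⟪p.2, v.2⟫ / ‖p.2‖ ^ 3 * ⟪cross p.1 p.2, w.2⟫ -
        ‖p.2‖⁻¹ * ⟪cross v.1 p.2 + cross p.1 v.2, w.2⟫)
    ((contDiffAt_rhoConnection hp).differentiableAt one_ne_zero) (fun v w => ?_) v w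
  have hn : ‖p.2‖ ≠ 0 := norm_ne_zero_iff.mpr hp
  have h1 := hasDerivAt_line p.1 v.1
  have h2 := hasDerivAt_line p.2 v.2
  have hc := ((h1.mul h2).sub (h2.mul h1)).const_smul (1 / 2 : ℝ)
  have hi := hc.inner ℝ (hasDerivAt_const (0 : ℝ) w.2)
  have hs : HasDerivAt (fun t : ℝ => ‖p.2 + t • v.2‖) (⟪p.2, v.2⟫ / ‖p.2‖) 0 := by
    have h3 := (h2.norm_sq).sqrt (by simpa using hp)
    simp only [sqrt_sq (norm_nonneg _)] at h3
    refine h3.congr_deriv ?_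
    simp
    field_simp
  have hinv := (hs.inv (by simpa using hp)).neg
  refine (hinv.mul hi).congr_deriv ?_ |>.congr_of_eventuallyEq (.of_forall fun t => ?_)
  · simp [cross, inner_add_left, inner_smul_left, inner_sub_left]
    field_simp
    ring
  · rfl

/-! ### The map from the nonzero quaternions to the cotangent bundle -/

theorem PhiExt_eq (u : ℍ) : PhiExt u = (sandwich u ((‖u‖ ^ 2)⁻¹ • qi), sandwich u qk) := by
  rw [sandwich_smul]
  rfl

theorem contDiffAt_PhiExt {n : WithTop ℕ∞} {u : ℍ} (hu : u ≠ 0) : ContDiffAt ℝ n PhiExt u := by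
  have h : ContDiffAt ℝ n (fun u : ℍ => (‖u‖ ^ 2)⁻¹) u :=
    (contDiff_norm_sq ℝ).contDiffAt.inv (pow_ne_zero 2 (norm_ne_zero_iff.mpr hu))
  unfold PhiExt
  fun_prop

theorem contDiff_Phi {n : WithTop ℕ∞} : ContDiff ℝ n Phi := by
  unfold Phi
  fun_prop

theorem hasDerivAt_sandwich_line (u v c : ℍ) :
    HasDerivAt (fun t : ℝ => sandwich (u + t • v) c)
      (star v * c * u + star u * c * v) 0 := by
  have h1 := hasDerivAt_line (star u) (star v)
  have h := (h1.mul_const c).mul (hasDerivAt_line u v)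
  simp only [zero_smul, add_zero] at h
  refine h.congr_of_eventuallyEq (.of_forall fun t => ?_)
  simp [sandwich]

theorem fderiv_Phi (u v : ℍ) : fderiv ℝ Phi u v =
    (star v * qi * u + star u * qi * v, star v * qk * u + star u * qk * v) :=
  fderiv_eq_of_line (contDiff_Phi.differentiable one_ne_zero u)
    ((hasDerivAt_sandwich_line u v qi).prodMk (hasDerivAt_sandwich_line u v qk))

theorem fderiv_PhiExt {u : ℍ} (hu : u ≠ 0) (v : ℍ) : fderiv ℝ PhiExt u v =
    ((‖u‖ ^ 2)⁻¹ • (star v * qi * u + star u * qi * v) -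
      (2 * ⟪u, v⟫ / (‖u‖ ^ 2) ^ 2) • sandwich u qi,
      star v * qk * u + star u * qk * v) := by
  refine fderiv_eq_of_line ((contDiffAt_PhiExt hu).differentiableAt one_ne_zero)
    (HasDerivAt.prodMk ?_ (hasDerivAt_sandwich_line u v qk))
  have h1 := ((hasDerivAt_line u v).norm_sq).inv (by simpa using hu)
  have h2 := h1.smul (hasDerivAt_sandwich_line u v qi)
  simp only [zero_smul, add_zero] at h2
  refine h2.congr_deriv ?_
  simp only [Pi.inv_apply, zero_smul, add_zero, neg_div, neg_smul]
  rw [sub_eq_add_neg]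

/-- Writing the tangent vector as `V * u` pulls the derivative through `sandwich u`, which is a
similarity. All later computations on tangent vectors thereby reduce to the components of `V`, with
`u` entering only through its norm. -/
theorem fderiv_PhiExt_mul {u : ℍ} (hu : u ≠ 0) (V : ℍ) : fderiv ℝ PhiExt u (V * u) =
    (sandwich u ((‖u‖ ^ 2)⁻¹ • quat 0 0 (-(2 * V.imK)) (2 * V.imJ)),
      sandwich u (quat 0 (-(2 * V.imJ)) (2 * V.imI) (2 * V.re))) := by
  have hn : ‖u‖ ^ 2 ≠ 0 := pow_ne_zero 2 (norm_ne_zero_iff.mpr hu)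
  have h : ∀ c, star (V * u) * c * u + star u * c * (V * u) = sandwich u (star V * c + c * V) :=
    fun c => by simp only [sandwich, star_mul, mul_add, add_mul, mul_assoc]
  have hin : ⟪u, V * u⟫ = ‖u‖ ^ 2 * V.re := by
    rw [norm_sq_coord]
    simp [inner_coord]
    ring
  rw [fderiv_PhiExt hu, h, h, hin]
  congr 1
  · rw [← sandwich_smul, ← sandwich_smul, ← sandwich_sub]
    congr 1
    generalize ‖u‖ ^ 2 = N at hn
    ext <;> simp <;> field_simp <;> ring
  · congr 1
    ext <;> simp <;> ring

theorem PhiExt_mem {u : ℍ} (hu : u ≠ 0) : PhiExt u ∈ cotS2 := by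
  have hn : ‖u‖ ^ 2 ≠ 0 := pow_ne_zero 2 (norm_ne_zero_iff.mpr hu)
  have h1 : ‖qi‖ = 1 := by
    rw [← sq_eq_sq₀ (norm_nonneg _) zero_le_one, norm_sq_coord]; simp
  have h2 : ‖qk‖ = 1 := by
    rw [← sq_eq_sq₀ (norm_nonneg _) zero_le_one, norm_sq_coord]; simp
  rw [PhiExt_eq]
  refine ⟨⟨?_, ?_⟩, ⟨?_, ?_⟩, ?_⟩
  · simp [re_sandwich]
  · rw [norm_sandwich, norm_smul, h1]
    simp [hn]
  · simp [re_sandwich]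
  · rw [inner_sandwich]
    simp [inner_coord]
  · rw [← norm_ne_zero_iff, norm_sandwich, h2]
    simpa using hu

theorem norm_PhiExt_snd (u : ℍ) : ‖(PhiExt u).2‖ = ‖u‖ ^ 2 := by
  have h2 : ‖qk‖ = 1 := by
    rw [← sq_eq_sq₀ (norm_nonneg _) zero_le_one, norm_sq_coord]; simp
  rw [PhiExt_eq, norm_sandwich, h2, mul_one]

theorem cross_PhiExt {u : ℍ} (hu : u ≠ 0) :
    cross (PhiExt u).1 (PhiExt u).2 = -sandwich u qj := by
  have hn : ‖u‖ ^ 2 ≠ 0 := pow_ne_zero 2 (norm_ne_zero_iff.mpr hu)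
  rw [PhiExt_eq, cross_sandwich, ← neg_one_smul ℝ (sandwich u qj), ← sandwich_smul]
  congr 1
  generalize ‖u‖ ^ 2 = N at hn
  rw [cross_eq]
  ext <;> simp [hn]

theorem exists_mul_eq {u : ℍ} (hu : u ≠ 0) (v : ℍ) : ∃ V, v = V * u :=
  ⟨v * u⁻¹, (inv_mul_cancel_right₀ hu v).symm⟩

theorem exists_fderiv_PhiExt_eq {u : ℍ} (hu : u ≠ 0) {w : ℍ × ℍ} (hw : w ∈ TcotS2 (PhiExt u)) :
    ∃ v, fderiv ℝ PhiExt u v = w := by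
  have hn : ‖u‖ ^ 2 ≠ 0 := pow_ne_zero 2 (norm_ne_zero_iff.mpr hu)
  obtain ⟨w1, w2⟩ := w
  obtain ⟨P, rfl⟩ := exists_sandwich_eq hu w1
  obtain ⟨Q, rfl⟩ := exists_sandwich_eq hu w2
  obtain ⟨⟨h1, h2⟩, h3, h4⟩ := hw
  rw [PhiExt_eq] at h2 h4
  simp only [re_sandwich, inner_sandwich, ← mul_add] at h1 h2 h3 h4
  have hP : P.re = 0 := (mul_eq_zero.mp h1).resolve_left hn
  have hPi := (mul_eq_zero.mp h2).resolve_left (pow_ne_zero 2 hn)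
  have hQ : Q.re = 0 := (mul_eq_zero.mp h3).resolve_left hn
  have hQi := (mul_eq_zero.mp h4).resolve_left (pow_ne_zero 2 hn)
  simp [inner_coord, hu] at hPi hQi
  clear h1 h2 h3 h4
  -- The witness solves the formula of `fderiv_PhiExt_mul` for `V`. The remaining component of `Q`
  -- is forced by the tangency condition `hQi`.
  refine ⟨quat (Q.imK / 2) (Q.imJ / 2) (‖u‖ ^ 2 * P.imK / 2) (-(‖u‖ ^ 2 * P.imJ / 2)) * u, ?_⟩
  rw [fderiv_PhiExt_mul hu]
  generalize ‖u‖ ^ 2 = N at *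
  congr 2
  · ext <;> simp [hP, hPi] <;> field_simp
  · ext <;> simp [hQ] <;> field_simp
    field_simp at hQi
    linarith

theorem fderiv_PhiExt_mem {u : ℍ} (hu : u ≠ 0) (v : ℍ) :
    fderiv ℝ PhiExt u v ∈ TcotS2 (PhiExt u) := by
  have hn : ‖u‖ ^ 2 ≠ 0 := pow_ne_zero 2 (norm_ne_zero_iff.mpr hu)
  obtain ⟨V, rfl⟩ := exists_mul_eq hu v
  rw [fderiv_PhiExt_mul hu, PhiExt_eq]
  refine ⟨⟨?_, ?_⟩, ?_, ?_⟩
  · simp [re_sandwich]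
  · rw [inner_sandwich]
    simp [inner_coord]
  · simp [re_sandwich]
  · simp only [inner_sandwich]
    generalize ‖u‖ ^ 2 = N at hn
    simp [inner_coord]

/-- The right-hand side does not depend on `u`: the lifted symplectic form has constant
coefficients, so Hamiltonians that lift to quadratic forms have linear flows. -/
theorem omegaTheta_PhiExt (θ : ℝ) {u : ℍ} (hu : u ≠ 0) (v w : ℍ) :
    omegaTheta θ (PhiExt u) (fderiv ℝ PhiExt u v) (fderiv ℝ PhiExt u w) =
      -4 * ⟪v, axis θ * w⟫ := by
  have hn : ‖u‖ ^ 2 ≠ 0 := pow_ne_zero 2 (norm_ne_zero_iff.mpr hu)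
  obtain ⟨V, rfl⟩ := exists_mul_eq hu v
  obtain ⟨W, rfl⟩ := exists_mul_eq hu w
  have hr : ⟪V * u, axis θ * (W * u)⟫ = ‖u‖ ^ 2 * ⟪V, axis θ * W⟫ := by
    rw [norm_sq_coord]
    simp [inner_coord]
    ring
  rw [omegaTheta, dForm_liouville, dForm_rhoConnection (PhiExt_mem hu).2.2, norm_PhiExt_snd,
    cross_PhiExt hu, hr]
  simp only [fderiv_PhiExt_mul hu, PhiExt_eq, cross_sandwich, ← sandwich_add, inner_sandwich,
    inner_neg_left]
  generalize ‖u‖ ^ 2 = N at hn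
  simp [inner_coord, cross_eq, axis]
  field_simp
  ring

theorem eq_zero_of_fderiv_PhiExt {u : ℍ} (hu : u ≠ 0) {v : ℍ} (h : fderiv ℝ PhiExt u v = 0) :
    v = 0 := by
  obtain ⟨V, rfl⟩ := exists_mul_eq hu v
  have hn : ‖u‖ ^ 2 ≠ 0 := pow_ne_zero 2 (norm_ne_zero_iff.mpr hu)
  have h0 : ∀ q, sandwich u q = 0 → q = 0 := fun q hq => by
    have h1 := norm_sandwich u q
    rw [hq, norm_zero, eq_comm, mul_eq_zero] at h1
    exact norm_eq_zero.mp (h1.resolve_left hn)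
  rw [fderiv_PhiExt_mul hu, Prod.mk_eq_zero] at h
  have h1 := (smul_eq_zero.mp (h0 _ h.1)).resolve_left (inv_ne_zero hn)
  have h2 := h0 _ h.2
  have e1 := congrArg (fun q : ℍ => q.imJ) h1
  have e2 := congrArg (fun q : ℍ => q.imJ) h2
  have e3 := congrArg (fun q : ℍ => q.imI) h2
  have e4 := congrArg (fun q : ℍ => q.imK) h2
  simp at e1 e2 e3 e4
  have : V = 0 := by ext <;> simp [e1, e2, e3, e4]
  rw [this, zero_mul]

theorem fderiv_Phi_eq {u : ℍ} (hu : u ∈ S3) {v : ℍ} (hv : v ∈ TS3 u) :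
    fderiv ℝ Phi u v = fderiv ℝ PhiExt u v := by
  have h1 : ‖u‖ = 1 := hu
  have hu0 : u ≠ 0 := norm_ne_zero_iff.mp (by rw [h1]; exact one_ne_zero)
  rw [fderiv_Phi, fderiv_PhiExt hu0, h1, show ⟪u, v⟫ = 0 from hv]
  simp

theorem Phi_eq_PhiExt {u : ℍ} (hu : u ∈ S3) : Phi u = PhiExt u := by
  rw [Phi, PhiExt, show ‖u‖ = 1 from hu]
  simp

/-- This yields surjectivity of `PhiExt`: an intertwiner `u` satisfies `ū i u = ‖u‖² x` and `ū k u =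
‖u‖² y`. It is found by averaging over the quaternion group, which acts by `i, k` on the left and by
the inverses of `x, y` on the right. -/
theorem exists_intertwiner {x y : ℍ} (hx : x * x = -1) (hy : y * y = -1) (hxy : x * y = -(y * x))
    (hx0 : x.re = 0) (hy0 : y.re = 0) :
    ∃ u : ℍ, u ≠ 0 ∧ qi * u = u * x ∧ qk * u = u * y := by
  have hi : qi * qi = -1 := by ext <;> simp
  have hk : qk * qk = -1 := by ext <;> simp
  have hik : qk * qi = -(qi * qk) := by ext <;> simp
  have hi' : ∀ q, qi * (qi * q) = -q := fun q => by rw [← mul_assoc, hi, neg_one_mul]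
  have hk' : ∀ q, qk * (qk * q) = -q := fun q => by rw [← mul_assoc, hk, neg_one_mul]
  have hik' : ∀ q, qk * (qi * q) = -(qi * (qk * q)) := fun q => by
    rw [← mul_assoc, hik, neg_mul, mul_assoc]
  have hyyx : y * (y * x) = -x := by rw [← mul_assoc, hy, neg_one_mul]
  -- Four times the average. The signs come from `x⁻¹ = -x`, `y⁻¹ = -y` and `(x y)⁻¹ = y x`.
  set P : ℍ → ℍ := fun q => q - qi * (q * x) - qk * (q * y) + qi * (qk * (q * (y * x))) with hP
  have hPi : ∀ q, qi * P q = P q * x := fun q => by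
    simp only [hP, mul_add, mul_sub, add_mul, sub_mul, hi', mul_assoc, hx, mul_neg, mul_one]
    abel
  have hPk : ∀ q, qk * P q = P q * y := fun q => by
    simp only [hP, mul_add, mul_sub, add_mul, sub_mul, hk', hik', mul_assoc, hy, hyyx, hxy, mul_neg,
      mul_one]
    abel
  by_contra! hne
  have h0 : ∀ q, P q = 0 := fun q => by
    by_contra hq
    exact hne _ hq (hPi q) (hPk q)
  -- These four equations add up to the trace of `P`. The trace of `q ↦ a q b` is `4 Re a Re b`, so
  -- only the identity term contributes and the trace is `4`, not `0`.
  have e1 := congrArg (fun q : ℍ => q.re) (h0 1)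
  have e2 := congrArg (fun q : ℍ => q.imI) (h0 qi)
  have e3 := congrArg (fun q : ℍ => q.imJ) (h0 qj)
  have e4 := congrArg (fun q : ℍ => q.imK) (h0 qk)
  simp [hP, hx0, hy0] at e1 e2 e3 e4
  linarith

theorem im_mul_self {x : ℍ} (hx : x.re = 0) (hn : ‖x‖ = 1) : x * x = -1 := by
  have h : ‖x‖ ^ 2 = 1 := by rw [hn, one_pow]
  rw [norm_sq_coord, hx] at h
  ext <;> simp [hx]
  · linarith
  all_goals ring

theorem exists_PhiExt_eq {p : ℍ × ℍ} (hp : p ∈ cotS2) : ∃ u, u ≠ 0 ∧ PhiExt u = p := by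
  obtain ⟨x, y⟩ := p
  obtain ⟨⟨hx0, hx⟩, ⟨hy0, hxy⟩, hy⟩ := hp
  dsimp only at hx0 hx hy0 hxy hy
  have hn : 0 < ‖y‖ := norm_pos_iff.mpr hy
  have hz0 : (‖y‖⁻¹ • y).re = 0 := by simp [hy0]
  have hz : ‖‖y‖⁻¹ • y‖ = 1 := by
    rw [norm_smul, norm_inv, norm_norm, inv_mul_cancel₀ hn.ne']
  have hanti : x * y = -(y * x) := by
    rw [inner_coord, hx0, hy0] at hxy
    ext <;> simp [hx0, hy0]
    · linarith
    all_goals ring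
  obtain ⟨u, hu, h1, h2⟩ := exists_intertwiner (im_mul_self hx0 hx) (im_mul_self hz0 hz)
    (by rw [mul_smul_comm, smul_mul_assoc, hanti, smul_neg]) hx0 hz0
  have hun : 0 < ‖u‖ := norm_pos_iff.mpr hu
  -- The intertwiner is rescaled so that its squared norm becomes `‖y‖`, the length of the covector.
  have hc : 0 < √‖y‖ / ‖u‖ := div_pos (sqrt_pos.mpr hn) hun
  have hcu : ‖(√‖y‖ / ‖u‖) • u‖ ^ 2 = ‖y‖ := by
    rw [norm_smul, norm_of_nonneg hc.le, div_mul_cancel₀ _ hun.ne', sq_sqrt hn.le]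
  have hs : ∀ c z : ℍ, c * u = u * z →
      star ((√‖y‖ / ‖u‖) • u) * c * ((√‖y‖ / ‖u‖) • u) = ‖y‖ • z := fun c z h => by
    rw [mul_assoc, mul_smul_comm, h, ← smul_mul_assoc, ← mul_assoc, star_mul_self_eq, hcu,
      smul_mul_assoc, one_mul]
  refine ⟨(√‖y‖ / ‖u‖) • u, smul_ne_zero hc.ne' hu, ?_⟩
  rw [PhiExt, hcu, hs _ _ h1, hs _ _ h2, smul_smul, smul_smul, inv_mul_cancel₀ hn.ne',
    mul_inv_cancel₀ hn.ne', one_smul, one_smul]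

theorem PhiExt_neg (u : ℍ) : PhiExt (-u) = PhiExt u := by
  simp [PhiExt]

theorem PhiExt_eq_iff {u v : ℍ} (hu : u ≠ 0) (hv : v ≠ 0) :
    PhiExt u = PhiExt v ↔ u = v ∨ u = -v := by
  constructor
  · intro h
    have hN : ‖u‖ ^ 2 = ‖v‖ ^ 2 := by rw [← norm_PhiExt_snd, ← norm_PhiExt_snd, h]
    have hn : ‖v‖ ^ 2 ≠ 0 := pow_ne_zero 2 (norm_ne_zero_iff.mpr hv)
    have h1 : star u * qi * u = star v * qi * v := by
      have := congrArg Prod.fst h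
      simp only [PhiExt, hN] at this
      exact smul_right_injective ℍ (inv_ne_zero hn) this
    have h2 : star u * qk * u = star v * qk * v := congrArg Prod.snd h
    -- Equal images make `v ū` commute with both `i` and `k`, hence real. As `‖u‖ = ‖v‖`, it can
    -- only be `±‖v‖²`.
    have hcomm : ∀ c, star u * c * u = star v * c * v →
        (v * star u) * c = c * (v * star u) := fun c hc => by
      have h3 : v * (star u * c * u) * star u = v * (star v * c * v) * star u := by rw [hc]
      have h4 : v * (star u * c * u) * star u = v * star u * c * (u * star u) := by
        simp only [mul_assoc]
      have h5 : v * (star v * c * v) * star u = (v * star v) * c * (v * star u) := by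
        simp only [mul_assoc]
      rw [h4, h5, mul_star_self_eq, mul_star_self_eq, hN, mul_smul_comm, smul_mul_assoc, mul_one,
        one_mul, smul_mul_assoc] at h3
      exact smul_right_injective ℍ hn h3
    have hi := hcomm _ h1
    have hk := hcomm _ h2
    have hvu : (v * star u) * u = (‖v‖ ^ 2) • v := by
      rw [mul_assoc, star_mul_self_eq, hN, mul_smul_comm, mul_one]
    have hnorm : ‖v * star u‖ ^ 2 = (‖v‖ ^ 2) ^ 2 := by
      rw [norm_mul, mul_pow, Quaternion.norm_star, hN, sq (‖v‖ ^ 2)]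
    generalize v * star u = w at *
    have e1 := congrArg (fun q : ℍ => q.imJ) hi
    have e2 := congrArg (fun q : ℍ => q.imK) hi
    have e3 := congrArg (fun q : ℍ => q.imJ) hk
    simp at e1 e2 e3
    have hK : w.imK = 0 := by linarith
    have hJ : w.imJ = 0 := by linarith
    have hI : w.imI = 0 := by linarith
    have hw : w = w.re • (1 : ℍ) := by ext <;> simp [hI, hJ, hK]
    rw [norm_sq_coord, hI, hJ, hK] at hnorm
    have hre : w.re = ‖v‖ ^ 2 ∨ w.re = -‖v‖ ^ 2 := sq_eq_sq_iff_eq_or_eq_neg.mp (by linarith)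
    rw [hw, smul_mul_assoc, one_mul] at hvu
    rcases hre with hre | hre
    · left
      rw [hre] at hvu
      exact smul_right_injective ℍ hn hvu
    · right
      rw [hre, neg_smul, ← smul_neg] at hvu
      rw [← smul_right_injective ℍ hn hvu, neg_neg]
  · rintro (rfl | rfl)
    · rfl
    · exact PhiExt_neg v

/-! ### Symplectic forms and Hamiltonian vector fields in the double cover -/

theorem axis_mul_axis (θ : ℝ) : axis θ * axis θ = -1 := by
  have h := sin_sq_add_cos_sq θ
  ext <;> simp [axis]
  · linarith
  · ring

theorem isNondegenerate_omegaTheta (θ : ℝ) : IsNondegenerate cotS2 TcotS2 (omegaTheta θ) := by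
  intro p hp v hv h
  obtain ⟨u, hu, rfl⟩ := exists_PhiExt_eq hp
  obtain ⟨v, rfl⟩ := exists_fderiv_PhiExt_eq hu hv
  -- Since `axis θ` squares to `-1`, it is a compatible complex structure: the form on `v` and `axis
  -- θ * v` is `4 ‖v‖²`.
  have h1 := h _ (fderiv_PhiExt_mem hu (axis θ * v))
  rw [omegaTheta_PhiExt θ hu, ← mul_assoc, axis_mul_axis, neg_one_mul, inner_neg_right] at h1
  have h2 : v = 0 := inner_self_eq_zero (𝕜 := ℝ).mp (by linarith)
  rw [h2, map_zero]

/-- Every tangent vector of the cotangent bundle comes from upstairs, so Hamilton's equation can be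
checked after pulling back. -/
theorem isHamiltonianVector_PhiExt {θ : ℝ} {H : ℍ × ℍ → ℝ} {u r : ℍ} (hu : u ≠ 0)
    (hH : DifferentiableAt ℝ H (PhiExt u))
    (h : ∀ w, 4 * ⟪r, axis θ * w⟫ = fderiv ℝ (H ∘ PhiExt) u w) :
    IsHamiltonianVector TcotS2 (omegaTheta θ) H (PhiExt u) (fderiv ℝ PhiExt u r) := by
  refine ⟨fderiv_PhiExt_mem hu r, fun w hw => ?_⟩
  obtain ⟨w, rfl⟩ := exists_fderiv_PhiExt_eq hu hw
  have h1 := h w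
  rw [fderiv_comp u hH ((contDiffAt_PhiExt hu).differentiableAt one_ne_zero)] at h1
  rw [omegaTheta_PhiExt θ hu]
  rw [ContinuousLinearMap.comp_apply] at h1
  linarith

/-! ### The Hamiltonian functions in the double cover -/

theorem sandwich_axis (θ : ℝ) (u : ℍ) :
    sandwich u (axis θ) = sandwich (star (rot θ) * u) qi := by
  rw [← rot_mul_qi_mul_star]
  simp only [sandwich, star_mul, star_star, mul_assoc]

theorem quadHam_eq (ε : ℝ) (w : ℍ) : quadHam ε w = ‖w‖ ^ 2 + ε * (sandwich w qi).imI := by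
  rw [norm_sq_coord]
  simp [quadHam, sandwich]
  ring

/-- Both `‖y‖ x` and `-(x × y)` lift to sandwiches, of `i` and of `j`, so the perturbation is `ε`
times the `i`-component of `ū (axis θ) u`. Conjugating `axis θ` back to `i` moves the rotation onto
`u`. -/
theorem ham_PhiExt (θ ε : ℝ) {u : ℍ} (hu : u ≠ 0) :
    ham θ ε (PhiExt u) = quadHam ε (star (rot θ) * u) := by
  have hn : ‖u‖ ^ 2 ≠ 0 := pow_ne_zero 2 (norm_ne_zero_iff.mpr hu)
  have h : sandwich u (axis θ) = cos θ • sandwich u qi + sin θ • sandwich u qj := by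
    rw [← sandwich_smul, ← sandwich_smul, ← sandwich_add]
    congr 1
    ext <;> simp [axis]
  rw [quadHam_eq, ← sandwich_axis, h, ham, norm_PhiExt_snd, cross_PhiExt hu, norm_star_rot_mul,
    PhiExt_eq]
  simp only [sandwich_smul, Quaternion.imI_add, Quaternion.imI_smul, Quaternion.imI_neg,
    smul_eq_mul]
  rw [mul_inv_cancel_left₀ hn]
  ring

theorem contDiffOn_ham {n : WithTop ℕ∞} (θ : ℝ) :
    ContDiffOn ℝ n (fun q : ℝ × (ℍ × ℍ) => ham θ q.1 q.2) {q | q.2.2 ≠ 0} := by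
  intro q hq
  have hn : ContDiffAt ℝ n (fun q : ℝ × (ℍ × ℍ) => ‖q.2.2‖) q :=
    ContDiffAt.norm ℝ (by fun_prop) hq
  have h1 : ContDiffAt ℝ n (fun q : ℝ × (ℍ × ℍ) => q.2.1.imI) q :=
    contDiff_imI.contDiffAt.comp q (by fun_prop)
  have h2 : ContDiffAt ℝ n (fun q : ℝ × (ℍ × ℍ) => (cross q.2.1 q.2.2).imI) q :=
    contDiff_imI.contDiffAt.comp q (contDiff_cross.contDiffAt.comp q (by fun_prop))
  refine ContDiffAt.contDiffWithinAt ?_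
  unfold ham
  fun_prop

theorem smoothNear_ham (θ : ℝ) :
    SmoothNear (univ ×ˢ cotS2) (fun q : ℝ × (ℍ × ℍ) => ham θ q.1 q.2) := by
  refine ⟨{q | q.2.2 ≠ 0}, ?_, fun q hq => hq.2.2.2, contDiffOn_ham θ⟩
  exact isOpen_compl_singleton.preimage (continuous_snd.comp continuous_snd)

theorem differentiableAt_ham (θ ε : ℝ) {p : ℍ × ℍ} (hp : p.2 ≠ 0) :
    DifferentiableAt ℝ (ham θ ε) p := by
  have ho : IsOpen {q : ℝ × (ℍ × ℍ) | q.2.2 ≠ 0} :=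
    isOpen_compl_singleton.preimage (continuous_snd.comp continuous_snd)
  have h := ((contDiffOn_ham (n := 1) θ).contDiffAt (ho.mem_nhds (x := (ε, p)) hp)).differentiableAt
    one_ne_zero
  exact h.comp p ((differentiableAt_const ε).prodMk differentiableAt_id)

theorem isHamiltonianVector_ham (θ ε : ℝ) {u : ℍ} (hu : u ≠ 0) :
    IsHamiltonianVector TcotS2 (omegaTheta θ) (ham θ ε) (PhiExt u)
      (fderiv ℝ PhiExt u (rot θ * reebOp ε (star (rot θ) * u))) := by
  have hd := differentiableAt_ham θ ε (PhiExt_mem hu).2.2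
  refine isHamiltonianVector_PhiExt hu hd fun w => ?_
  rw [← rot_mul_qi_mul_star, mul_assoc, mul_assoc, inner_rot_mul]
  have hdc : DifferentiableAt ℝ (ham θ ε ∘ PhiExt) u :=
    hd.comp u ((contDiffAt_PhiExt hu).differentiableAt one_ne_zero)
  refine (fderiv_eq_of_line hdc ?_).symm
  have hev : ∀ᶠ t : ℝ in nhds 0, u + t • w ≠ 0 :=
    (hasDerivAt_line u w).continuousAt.eventually_ne (by simpa using hu)
  set a := star (rot θ) * u
  set b := star (rot θ) * w
  -- The exact Taylor expansion of a quadratic form; its linear term displays `reebOp ε a` as the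
  -- Hamiltonian vector at `a`.
  have hq : ∀ t : ℝ, quadHam ε (a + t • b) =
      quadHam ε a + t * (4 * ⟪reebOp ε a, qi * b⟫) + t ^ 2 * quadHam ε b := fun t => by
    simp [quadHam, inner_coord, reebOp]
    ring
  have h1 : HasDerivAt (fun t : ℝ => quadHam ε a + t * (4 * ⟪reebOp ε a, qi * b⟫) +
      t ^ 2 * quadHam ε b) (4 * ⟪reebOp ε a, qi * b⟫) 0 := by
    have := (((hasDerivAt_id (0 : ℝ)).mul_const (4 * ⟪reebOp ε a, qi * b⟫)).const_add
      (quadHam ε a)).add (((hasDerivAt_id (0 : ℝ)).pow 2).mul_const (quadHam ε b))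
    exact this.congr_deriv (by simp)
  refine h1.congr_of_eventuallyEq (hev.mono fun t ht => ?_)
  refine (ham_PhiExt θ ε ht).trans (Eq.trans ?_ (hq t))
  rw [mul_add, mul_smul_comm]

/-! ### Double covers by the sphere -/

theorem neg_mem_S3 {u : ℍ} (hu : u ∈ S3) : -u ∈ S3 := (norm_neg u).trans hu

theorem ne_zero_of_mem_S3 {u : ℍ} (hu : u ∈ S3) : u ≠ 0 :=
  norm_ne_zero_iff.mp (by rw [show ‖u‖ = 1 from hu]; exact one_ne_zero)

theorem ne_neg_of_mem_S3 {u : ℍ} (hu : u ∈ S3) : u ≠ -u := fun h => by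
  have h2 : (2 : ℝ) • u = 0 := by
    rw [two_smul]
    nth_rw 1 [h]
    exact neg_add_cancel u
  exact ne_zero_of_mem_S3 hu ((smul_eq_zero.mp h2).resolve_left two_ne_zero)

instance : CompactSpace S3 := by
  have h : S3 = Metric.sphere (0 : ℍ) 1 := by
    ext u
    simp [S3]
  rw [h]
  exact isCompact_iff_compactSpace.mp (isCompact_sphere 0 1)

/-- All topology is reduced to antipodal fibres: compactness of the sphere and the free antipodal
involution make the map a covering, with no separate study of the target. -/
theorem isDoubleCover_of_fibers {f : ℍ → ℍ × ℍ} {N : Set (ℍ × ℍ)} (hf : MapsTo f S3 N)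
    (hs : SmoothNear S3 f) (hi : ∀ p ∈ S3, ∀ v ∈ TS3 p, fderiv ℝ f p v = 0 → v = 0)
    (hsurj : ∀ q ∈ N, ∃ u ∈ S3, f u = q)
    (hfib : ∀ u ∈ S3, ∀ v ∈ S3, f u = f v ↔ u = v ∨ u = -v) :
    IsDoubleCover f S3 TS3 N := by
  refine ⟨hf, hs, hi, ?_, ?_⟩
  · obtain ⟨U, hU, hSU, hfU⟩ := hs
    have hc : Continuous (hf.restrict f S3 N) :=
      (hfU.continuousOn.mono hSU).mapsToRestrict hf
    refine isCoveringMap_of_involution hc ?_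
      (σ := fun u : S3 => ⟨-(u : ℍ), neg_mem_S3 u.2⟩) (by fun_prop) (fun u => by simp) ?_ ?_
    · rintro ⟨q, hq⟩
      obtain ⟨u, hu, rfl⟩ := hsurj q hq
      exact ⟨⟨u, hu⟩, rfl⟩
    · intro u h
      exact ne_neg_of_mem_S3 u.2 (congrArg Subtype.val h).symm
    · intro u v
      rw [Subtype.ext_iff, Subtype.ext_iff, Subtype.ext_iff]
      exact hfib u u.2 v v.2
  · intro q hq
    obtain ⟨u, hu, rfl⟩ := hsurj q hq
    have : {p | p ∈ S3 ∧ f p = f u} = {u, -u} := by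
      ext p
      constructor
      · rintro ⟨hp, h⟩
        exact (hfib p hp u hu).mp h
      · rintro (rfl | rfl)
        · exact ⟨hu, rfl⟩
        · exact ⟨neg_mem_S3 hu, (hfib _ (neg_mem_S3 hu) u hu).mpr (Or.inr rfl)⟩
    rw [this]
    exact ncard_pair (ne_neg_of_mem_S3 hu)

/-- The linear flow commutes with the antipodal map, so it descends. The explicit formula for the
descended flow is recorded because the Hamiltonian, periodicity and geodesic properties are all read
off from it. -/
theorem exists_flow_doublyCovers {f : ℍ → ℍ × ℍ} {N : Set (ℍ × ℍ)} (hf : IsDoubleCover f S3 TS3 N)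
    (hsurj : ∀ q ∈ N, ∃ u ∈ S3, f u = q)
    (hfib : ∀ u ∈ S3, ∀ v ∈ S3, f u = f v ↔ u = v ∨ u = -v) (θ ε : ℝ) :
    ∃ ψ : Flow ℝ N, DoublyCovers f S3 TS3 N (reebFlow θ ε) ψ ∧
      ∀ t u (hu : u ∈ S3), (ψ t ⟨f u, hf.mapsTo hu⟩ : ℍ × ℍ) = f (rotFlow θ ε t u) := by
  have hsur : Function.Surjective (hf.mapsTo.restrict f S3 N) := by
    rintro ⟨q, hq⟩
    obtain ⟨u, hu, rfl⟩ := hsurj q hq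
    exact ⟨⟨u, hu⟩, rfl⟩
  have hq : IsOpenQuotientMap (hf.mapsTo.restrict f S3 N) :=
    ⟨hsur, hf.covering.continuous, hf.covering.isOpenMap⟩
  obtain ⟨ψ, hψ⟩ := exists_flow_of_isOpenQuotientMap hq (reebFlow θ ε) fun t u v h => by
    have h1 : f u = f v := congrArg Subtype.val h
    refine Subtype.ext ?_
    change f (rotFlow θ ε t u) = f (rotFlow θ ε t v)
    rcases (hfib u u.2 v v.2).mp h1 with h2 | h2
    · rw [h2]
    · rw [h2, rotFlow_neg]
      exact (hfib _ (neg_mem_S3 (rotFlow_mem θ ε t v.2)) _ (rotFlow_mem θ ε t v.2)).mpr (Or.inr rfl)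
  refine ⟨ψ, ⟨hf, hq.continuous, hsur, fun t u => (hψ t u).symm⟩, fun t u hu => ?_⟩
  exact congrArg Subtype.val (hψ t ⟨u, hu⟩)

theorem hasDerivAt_PhiExt_rotFlow (θ ε t : ℝ) {u : ℍ} (hu : u ≠ 0) :
    HasDerivAt (fun s => PhiExt (rotFlow θ ε s u)) (fderiv ℝ PhiExt (rotFlow θ ε t u)
      (rot θ * reebOp ε (star (rot θ) * rotFlow θ ε t u))) t := by
  have h : rotFlow θ ε t u ≠ 0 := by
    rw [← norm_ne_zero_iff, norm_rotFlow]
    exact norm_ne_zero_iff.mpr hu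
  exact ((contDiffAt_PhiExt h).differentiableAt one_ne_zero).hasFDerivAt.comp_hasDerivAt t
    (hasDerivAt_rotFlow θ ε t u)

/-! ### The unperturbed flow on the unit cotangent bundle -/

theorem exists_mem_S3_Phi_eq {q : ℍ × ℍ} (hq : q ∈ unitCot) : ∃ u ∈ S3, Phi u = q := by
  obtain ⟨u, hu, rfl⟩ := exists_PhiExt_eq hq.1
  have h := hq.2
  rw [norm_PhiExt_snd] at h
  have hu1 : u ∈ S3 := (pow_eq_one_iff_of_nonneg (norm_nonneg _) two_ne_zero).mp h
  exact ⟨u, hu1, Phi_eq_PhiExt hu1⟩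

theorem Phi_eq_iff {u v : ℍ} (hu : u ∈ S3) (hv : v ∈ S3) : Phi u = Phi v ↔ u = v ∨ u = -v := by
  rw [Phi_eq_PhiExt hu, Phi_eq_PhiExt hv,
    PhiExt_eq_iff (ne_zero_of_mem_S3 hu) (ne_zero_of_mem_S3 hv)]

theorem Phi_mem {u : ℍ} (hu : u ∈ S3) : Phi u ∈ unitCot := by
  rw [Phi_eq_PhiExt hu]
  refine ⟨PhiExt_mem (ne_zero_of_mem_S3 hu), ?_⟩
  rw [norm_PhiExt_snd, show ‖u‖ = 1 from hu, one_pow]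

theorem isDoubleCover_Phi : IsDoubleCover Phi S3 TS3 unitCot := by
  refine isDoubleCover_of_fibers (fun u hu => Phi_mem hu)
    ⟨univ, isOpen_univ, subset_univ _, contDiff_Phi.contDiffOn⟩ (fun u hu v hv h => ?_)
    (fun q hq => exists_mem_S3_Phi_eq hq) (fun u hu v hv => Phi_eq_iff hu hv)
  rw [fderiv_Phi_eq hu hv] at h
  exact eq_zero_of_fderiv_PhiExt (ne_zero_of_mem_S3 hu) h

theorem fderiv_kinetic (p w : ℍ × ℍ) : fderiv ℝ kinetic p w = ⟪p.2, w.2⟫ := by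
  have hd : Differentiable ℝ kinetic := by
    have h : ContDiff ℝ 1 fun p : ℍ × ℍ => ‖p.2‖ ^ 2 := contDiff_snd.norm_sq ℝ
    exact (h.div_const 2).differentiable one_ne_zero
  refine fderiv_eq_of_line (hd p) ?_
  have := ((hasDerivAt_line p.2 w.2).norm_sq).div_const 2
  refine this.congr_deriv ?_
  simp

theorem isHamiltonianVector_kinetic (θ : ℝ) {u : ℍ} (hu : u ∈ S3) :
    IsHamiltonianVector TcotS2 (omegaTheta θ) kinetic (PhiExt u)
      (fderiv ℝ PhiExt u (rot θ * reebOp 0 (star (rot θ) * u))) := by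
  have hu0 := ne_zero_of_mem_S3 hu
  obtain ⟨h1, h2⟩ := isHamiltonianVector_ham θ 0 hu0
  refine ⟨h1, fun w hw => ?_⟩
  have hp : ‖(PhiExt u).2‖ = 1 := by rw [norm_PhiExt_snd, show ‖u‖ = 1 from hu, one_pow]
  have hd := differentiableAt_ham θ 0 (PhiExt_mem hu0).2.2
  -- The kinetic energy is half the square of the unperturbed Hamiltonian. That Hamiltonian equals
  -- one here, so the two differentials agree.
  have hk : kinetic = fun p => ham θ 0 p ^ 2 / 2 := by
    funext p
    simp [kinetic, ham]
  have h3 : HasFDerivAt kinetic ((ham θ 0 (PhiExt u)) • fderiv ℝ (ham θ 0) (PhiExt u))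
      (PhiExt u) := by
    rw [hk]
    have h4 := (hd.hasFDerivAt.pow 2).mul_const (1 / 2 : ℝ)
    simp only [mul_one_div] at h4
    refine h4.congr_fderiv ?_
    ext v <;> simp <;> ring
  rw [h2 w hw, h3.fderiv]
  simp [ham, hp]

theorem rot_mul_reebOp_zero (θ : ℝ) (u : ℍ) :
    rot θ * reebOp 0 (star (rot θ) * u) = ((1 / 2 : ℝ) • axis θ) * u := by
  have h : ∀ w, reebOp 0 w = (1 / 2 : ℝ) • (qi * w) := fun w => by
    ext <;> simp [reebOp]
  rw [h, ← rot_mul_qi_mul_star]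
  simp only [mul_smul_comm, smul_mul_assoc, mul_assoc]

/-- On `ρ = 1`, `d(ρα)` exceeds `π^*σ₀` by `dρ ∧ α`, so `ω^θ` is not a multiple of the magnetic
form. But along the lifted field `X` one has `dρ(X) = 0` and `α(X) = cos θ`, so the extra term turns
`dρ` into `(1 - cos² θ) dρ = sin² θ dρ`. One factor `sin θ` belongs to the form and the other to the
time change. -/
theorem magneticForm_PhiExt {θ : ℝ} (hθ : sin θ ≠ 0) {u : ℍ} (hu : u ∈ S3) {w : ℍ × ℍ}
    (hw : w ∈ TcotS2 (PhiExt u)) :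
    magneticForm (-cot θ) (PhiExt u) ((sin θ)⁻¹ •
      fderiv ℝ PhiExt u (rot θ * reebOp 0 (star (rot θ) * u))) w =
      -(fderiv ℝ kinetic (PhiExt u) w) := by
  have hu0 := ne_zero_of_mem_S3 hu
  obtain ⟨w, rfl⟩ := exists_fderiv_PhiExt_eq hu0 hw
  obtain ⟨W, rfl⟩ := exists_mul_eq hu0 w
  have hn : ‖u‖ = 1 := hu
  rw [fderiv_kinetic, magneticForm, dForm_liouville, area, rot_mul_reebOp_zero,
    fderiv_PhiExt_mul hu0, fderiv_PhiExt_mul hu0, PhiExt_eq, cot_eq_cos_div_sin]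
  simp only [Prod.smul_mk, ← sandwich_smul, cross_sandwich, inner_sandwich, hn, one_pow]
  simp [inner_coord, cross_eq, axis]
  field_simp
  ring

theorem exists_unperturbed_flow (θ : ℝ) : ∃ (φ : Flow ℝ S3) (ψ : Flow ℝ unitCot),
    IsReebFlow S3 TS3 (alphaTheta θ) φ ∧
    (∀ u, φ (4 * π) u = u ∧ ∀ t, 0 < t → t < 4 * π → φ t u ≠ u) ∧
    IsHamiltonianFlow unitCot TcotS2 (omegaTheta θ) kinetic ψ ∧
    DoublyCovers Phi S3 TS3 unitCot φ ψ ∧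
    (sin θ ≠ 0 → ∃ ψ' : Flow ℝ unitCot, (∀ t p, ψ' t p = ψ (t / sin θ) p) ∧
      IsHamiltonianFlow unitCot TcotS2 (magneticForm (-cot θ)) kinetic ψ') := by
  obtain ⟨ψ, hψ, hψf⟩ := exists_flow_doublyCovers isDoubleCover_Phi
    (fun q hq => exists_mem_S3_Phi_eq hq) (fun u hu v hv => Phi_eq_iff hu hv) θ 0
  have hψP : ∀ t u (hu : u ∈ S3), (ψ t ⟨Phi u, Phi_mem hu⟩ : ℍ × ℍ) = PhiExt (rotFlow θ 0 t u) :=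
    fun t u hu => (hψf t u hu).trans (Phi_eq_PhiExt (rotFlow_mem θ 0 t hu))
  refine ⟨reebFlow θ 0, ψ, ?_, reebFlow_four_pi θ, ?_, hψ, ?_⟩
  · rw [← alphaThetaDef_zero_right]
    exact isReebFlow_reebFlow θ ⟨le_rfl, one_pos⟩
  · rintro ⟨p, hp⟩ t
    obtain ⟨u, hu, rfl⟩ := exists_mem_S3_Phi_eq hp
    simp only [hψP _ u hu]
    exact ⟨_, hasDerivAt_PhiExt_rotFlow θ 0 t (ne_zero_of_mem_S3 hu),
      isHamiltonianVector_kinetic θ (rotFlow_mem θ 0 t hu)⟩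
  · intro hs
    refine ⟨⟨fun t p => ψ (t / sin θ) p, ?_, fun s t p => ?_, fun p => ?_⟩, fun t p => rfl, ?_⟩
    · exact ψ.continuous (continuous_fst.div_const _) continuous_snd
    · rw [add_div, ψ.map_add]
    · rw [zero_div, ψ.map_zero_apply]
    · rintro ⟨p, hp⟩ t
      obtain ⟨u, hu, rfl⟩ := exists_mem_S3_Phi_eq hp
      change ∃ X, HasDerivAt (fun s => (ψ (s / sin θ) ⟨Phi u, hp⟩ : ℍ × ℍ)) X t ∧
        IsHamiltonianVector TcotS2 (magneticForm (-cot θ)) kinetic (ψ (t / sin θ) ⟨Phi u, hp⟩) X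
      simp only [hψP _ u hu]
      have hv := rotFlow_mem θ 0 (t / sin θ) hu
      have h1 := (hasDerivAt_PhiExt_rotFlow θ 0 (t / sin θ) (ne_zero_of_mem_S3 hu)).scomp t
        ((hasDerivAt_id t).div_const (sin θ))
      rw [one_div] at h1
      refine ⟨_, h1, ?_, fun w hw => magneticForm_PhiExt hs hv hw⟩
      rw [← map_smul]
      exact fderiv_PhiExt_mem (ne_zero_of_mem_S3 hv) _

/-! ### The double cover of a level set of the perturbed Hamiltonian -/

/-- The linear map `ellipsoid`, rotated by `rot θ`. -/
def rotEllipsoid (θ ε : ℝ) : ℍ →L[ℝ] ℍ :=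
  (ContinuousLinearMap.mul ℝ ℍ (rot θ)).comp ((LinearMap.toContinuousLinearMap
    { toFun := fun u => quat (u.re / √(1 + ε)) (u.imI / √(1 + ε)) (u.imJ / √(1 - ε))
        (u.imK / √(1 - ε))
      map_add' := fun u v => by ext <;> simp [add_div]
      map_smul' := fun c u => by ext <;> simp [mul_div_assoc] }).comp
    (ContinuousLinearMap.mul ℝ ℍ (star (rot θ))))

theorem rotEllipsoid_apply (θ ε : ℝ) (u : ℍ) :
    rotEllipsoid θ ε u = rot θ * ellipsoid ε (star (rot θ) * u) := rfl

theorem coverDef_eq (θ ε : ℝ) (u : ℍ) : coverDef θ ε u = PhiExt (rotEllipsoid θ ε u) := rfl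

theorem ellipsoid_eq (ε : ℝ) (u : ℍ) : ellipsoid ε u = quat (u.re / √(1 + ε)) (u.imI / √(1 + ε))
    (u.imJ / √(1 - ε)) (u.imK / √(1 - ε)) := rfl

section

variable {ε : ℝ} (hε : ε ∈ Ico (0 : ℝ) 1)
include hε

theorem sqrt_one_add_ne_zero : √(1 + ε) ≠ 0 := (sqrt_pos.mpr (by linarith [hε.1])).ne'

theorem sqrt_one_sub_ne_zero : √(1 - ε) ≠ 0 := (sqrt_pos.mpr (by linarith [hε.2])).ne'

theorem quadHam_ellipsoid (u : ℍ) : quadHam ε (ellipsoid ε u) = ‖u‖ ^ 2 := by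
  have h1 : (0 : ℝ) < 1 + ε := by linarith [hε.1]
  have h2 : (0 : ℝ) < 1 - ε := by linarith [hε.2]
  rw [norm_sq_coord, ellipsoid_eq]
  simp only [quadHam, quat_re, quat_imI, quat_imJ, quat_imK, div_pow, sq_sqrt h1.le, sq_sqrt h2.le]
  field_simp
  ring

theorem exists_ellipsoid_eq (w : ℍ) : ∃ u, ellipsoid ε u = w := by
  have h1 := sqrt_one_add_ne_zero hε
  have h2 := sqrt_one_sub_ne_zero hε
  refine ⟨quat (√(1 + ε) * w.re) (√(1 + ε) * w.imI) (√(1 - ε) * w.imJ) (√(1 - ε) * w.imK), ?_⟩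
  rw [ellipsoid_eq]
  ext <;> simp [h1, h2]

theorem exists_rotEllipsoid_eq (θ : ℝ) (w : ℍ) : ∃ u, rotEllipsoid θ ε u = w := by
  obtain ⟨v, hv⟩ := exists_ellipsoid_eq hε (star (rot θ) * w)
  refine ⟨rot θ * v, ?_⟩
  rw [rotEllipsoid_apply, star_rot_mul_cancel, hv, rot_mul_cancel]

theorem rotEllipsoid_injective (θ : ℝ) : Function.Injective (rotEllipsoid θ ε) :=
  LinearMap.injective_iff_surjective.mpr (exists_rotEllipsoid_eq hε θ)

theorem rotEllipsoid_ne_zero (θ : ℝ) {u : ℍ} (hu : u ≠ 0) : rotEllipsoid θ ε u ≠ 0 := fun h =>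
  hu (rotEllipsoid_injective hε θ (h.trans (map_zero _).symm))

theorem ham_PhiExt_rotEllipsoid (θ : ℝ) {u : ℍ} (hu : u ≠ 0) :
    ham θ ε (PhiExt (rotEllipsoid θ ε u)) = ‖u‖ ^ 2 := by
  rw [ham_PhiExt θ ε (rotEllipsoid_ne_zero hε θ hu), rotEllipsoid_apply, star_rot_mul_cancel,
    quadHam_ellipsoid hε, norm_star_rot_mul]

theorem coverDef_mem (θ : ℝ) {u : ℍ} (hu : u ∈ S3) : coverDef θ ε u ∈ level θ ε := by
  have hu0 := ne_zero_of_mem_S3 hu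
  refine ⟨PhiExt_mem (rotEllipsoid_ne_zero hε θ hu0), ?_⟩
  rw [coverDef_eq, ham_PhiExt_rotEllipsoid hε θ hu0, show ‖u‖ = 1 from hu, one_pow]

theorem exists_coverDef_eq (θ : ℝ) {q : ℍ × ℍ} (hq : q ∈ level θ ε) :
    ∃ u ∈ S3, coverDef θ ε u = q := by
  obtain ⟨v, hv, rfl⟩ := exists_PhiExt_eq hq.1
  obtain ⟨u, rfl⟩ := exists_rotEllipsoid_eq hε θ v
  have hu : u ≠ 0 := fun h => hv (by rw [h, map_zero])
  have h := hq.2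
  rw [ham_PhiExt_rotEllipsoid hε θ hu] at h
  exact ⟨u, (pow_eq_one_iff_of_nonneg (norm_nonneg _) two_ne_zero).mp h, rfl⟩

theorem coverDef_eq_iff (θ : ℝ) {u v : ℍ} (hu : u ∈ S3) (hv : v ∈ S3) :
    coverDef θ ε u = coverDef θ ε v ↔ u = v ∨ u = -v := by
  rw [coverDef_eq, coverDef_eq, PhiExt_eq_iff (rotEllipsoid_ne_zero hε θ (ne_zero_of_mem_S3 hu))
    (rotEllipsoid_ne_zero hε θ (ne_zero_of_mem_S3 hv)), ← map_neg,
    (rotEllipsoid_injective hε θ).eq_iff, (rotEllipsoid_injective hε θ).eq_iff]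

theorem contDiffAt_coverDef (θ : ℝ) {n : WithTop ℕ∞} {u : ℍ} (hu : u ≠ 0) :
    ContDiffAt ℝ n (coverDef θ ε) u :=
  (contDiffAt_PhiExt (rotEllipsoid_ne_zero hε θ hu)).comp u
    (rotEllipsoid θ ε).contDiff.contDiffAt

theorem isDoubleCover_coverDef (θ : ℝ) : IsDoubleCover (coverDef θ ε) S3 TS3 (level θ ε) := by
  refine isDoubleCover_of_fibers (fun u hu => coverDef_mem hε θ hu)
    ⟨{0}ᶜ, isOpen_compl_singleton, fun u hu => ne_zero_of_mem_S3 hu, fun u hu =>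
      (contDiffAt_coverDef hε θ hu).contDiffWithinAt⟩ (fun u hu v hv h => ?_)
    (fun q hq => exists_coverDef_eq hε θ hq) (fun u hu v hv => coverDef_eq_iff hε θ hu hv)
  have hu0 := rotEllipsoid_ne_zero hε θ (ne_zero_of_mem_S3 hu)
  have hd : HasFDerivAt (coverDef θ ε)
      ((fderiv ℝ PhiExt (rotEllipsoid θ ε u)).comp (rotEllipsoid θ ε)) u :=
    ((contDiffAt_PhiExt hu0).differentiableAt one_ne_zero).hasFDerivAt.comp u
      (rotEllipsoid θ ε).hasFDerivAt
  rw [hd.fderiv] at h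
  exact rotEllipsoid_injective hε θ ((eq_zero_of_fderiv_PhiExt hu0 h).trans (map_zero _).symm)

omit hε in
-- The ellipsoid map is a real scaling of each of `z₀`, `z₁`, and so commutes with their rotations.
theorem rotEllipsoid_rotFlow (θ t : ℝ) (u : ℍ) :
    rotEllipsoid θ ε (rotFlow θ ε t u) = rotFlow θ ε t (rotEllipsoid θ ε u) := by
  rw [rotEllipsoid_apply, rotEllipsoid_apply, star_rot_mul_rotFlow, rotFlow, star_rot_mul_cancel]
  congr 1
  simp only [ellipsoid_eq]
  ext <;> simp [baseFlow] <;> ring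

theorem hasDerivAt_coverDef_rotFlow (θ t : ℝ) {u : ℍ} (hu : u ∈ S3) :
    ∃ X, HasDerivAt (fun s => coverDef θ ε (rotFlow θ ε s u)) X t ∧
      IsHamiltonianVector TcotS2 (omegaTheta θ) (ham θ ε) (coverDef θ ε (rotFlow θ ε t u)) X := by
  have h := rotEllipsoid_ne_zero hε θ (ne_zero_of_mem_S3 hu)
  simp only [coverDef_eq, rotEllipsoid_rotFlow]
  refine ⟨_, hasDerivAt_PhiExt_rotFlow θ ε t h, isHamiltonianVector_ham θ ε ?_⟩
  rw [← norm_ne_zero_iff, norm_rotFlow]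
  exact norm_ne_zero_iff.mpr h

end

/-! ### Periodic orbits -/

/-- A plane rotation with a real eigenvector is `±1`, so the sine of its angle vanishes. -/
theorem exists_int_mul_pi_of_rotation {a x y s : ℝ} (hxy : x ≠ 0 ∨ y ≠ 0)
    (h1 : cos a * x - sin a * y = s * x) (h2 : sin a * x + cos a * y = s * y) :
    ∃ n : ℤ, n * π = a := by
  refine sin_eq_zero_iff.mp ?_
  have h3 : sin a * (x ^ 2 + y ^ 2) = 0 := by linear_combination x * h2 - y * h1
  have h4 : x ^ 2 + y ^ 2 ≠ 0 := by
    rcases hxy with h | h <;> positivity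
  exact (mul_eq_zero.mp h3).resolve_right h4

theorem baseFlow_periodic_of_irrational {ε : ℝ} (hε : ε ∈ Ico (0 : ℝ) 1) (hirr : Irrational ε)
    {τ : ℝ} (hτ : 0 < τ) {w : ℍ} (hw : baseFlow ε τ w = w ∨ baseFlow ε τ w = -w) :
    (w.re = 0 ∧ w.imI = 0) ∨ (w.imJ = 0 ∧ w.imK = 0) := by
  obtain ⟨s, h⟩ : ∃ s : ℝ, baseFlow ε τ w = s • w := by
    rcases hw with h | h
    · exact ⟨1, by rw [h, one_smul]⟩
    · exact ⟨-1, by rw [h, neg_one_smul]⟩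
  by_contra! hne
  have e1 := congrArg (fun q : ℍ => q.re) h
  have e2 := congrArg (fun q : ℍ => q.imI) h
  have e3 := congrArg (fun q : ℍ => q.imJ) h
  have e4 := congrArg (fun q : ℍ => q.imK) h
  simp only [baseFlow, quat_re, quat_imI, quat_imJ, quat_imK, Quaternion.re_smul,
    Quaternion.imI_smul, Quaternion.imJ_smul, Quaternion.imK_smul, smul_eq_mul] at e1 e2 e3 e4
  -- Both angles are integer multiples of `π`, with `m` for `z₀` and `n` for `z₁`. Their sum is `τ`
  -- and their difference `ε τ`, so `ε = (m - n) / (m + n)`. Only multiples of `π` arise because a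
  -- return to `-w` also closes the orbit downstairs.
  obtain ⟨m, hm⟩ := exists_int_mul_pi_of_rotation
    (by by_contra! hc; exact hne.1 hc.1 hc.2) e1 e2
  obtain ⟨n, hn⟩ := exists_int_mul_pi_of_rotation
    (by by_contra! hc; exact hne.2 hc.1 hc.2) e3 e4
  have h1 : (0 : ℝ) < 1 - ε := by linarith [hε.2]
  have h2 : (0 : ℝ) < 1 + ε := by linarith [hε.1]
  have hsum : ((m : ℝ) + n) * π = τ := by linear_combination hm + hn
  have hpos : (0 : ℝ) < (m : ℝ) + n := by
    by_contra! hc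
    nlinarith [pi_pos]
  have heq : ε * ((m : ℝ) + n) = m - n := by
    have h3 : (ε * ((m : ℝ) + n)) * π = ((m : ℝ) - n) * π := by
      linear_combination ε * hsum - hm + hn
    exact mul_right_cancel₀ pi_ne_zero h3
  refine hirr ⟨((m : ℚ) - n) / ((m : ℚ) + n), ?_⟩
  push_cast
  rw [div_eq_iff hpos.ne', heq]

theorem exists_angle {x y : ℝ} (h : x ^ 2 + y ^ 2 = 1) : ∃ s, x = cos s ∧ y = sin s := by
  have hn : ‖(⟨x, y⟩ : ℂ)‖ = 1 := by
    rw [Complex.norm_def, Complex.normSq_mk, ← sq, ← sq, h, sqrt_one]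
  have h0 : (⟨x, y⟩ : ℂ) ≠ 0 := norm_ne_zero_iff.mp (by rw [hn]; exact one_ne_zero)
  refine ⟨Complex.arg ⟨x, y⟩, ?_, ?_⟩
  · rw [Complex.cos_arg h0, hn, div_one]
  · rw [Complex.sin_arg, hn, div_one]

theorem orbit_eq_of_eq {X : Type*} [TopologicalSpace X] (ψ : Flow ℝ X) {p q : X} {t : ℝ}
    (h : p = ψ t q) : ψ.orbit p = ψ.orbit q := by
  have key : ∀ {p q : X} {t : ℝ}, p = ψ t q → ψ.orbit p ⊆ ψ.orbit q := by
    rintro p q t rfl x hx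
    obtain ⟨s, rfl⟩ := ψ.mem_orbit_iff.mp hx
    exact ψ.mem_orbit_iff.mpr ⟨s + t, ψ.map_add s t q⟩
  refine (key h).antisymm (key (t := -t) ?_)
  rw [h, ← ψ.map_add, neg_add_cancel, ψ.map_zero_apply]

theorem ncard_periodicOrbits {θ ε : ℝ} (hε : ε ∈ Ico (0 : ℝ) 1) (hirr : Irrational ε)
    {ψ : Flow ℝ (level θ ε)} (hψ : ∀ t u (hu : u ∈ S3),
      (ψ t ⟨coverDef θ ε u, coverDef_mem hε θ hu⟩ : ℍ × ℍ) = coverDef θ ε (rotFlow θ ε t u)) :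
    (periodicOrbits ψ).ncard = 2 := by
  have h1 : (0 : ℝ) < 1 - ε := by linarith [hε.2]
  have h2 : (0 : ℝ) < 1 + ε := by linarith [hε.1]
  have hS : ∀ w : ℍ, ‖w‖ ^ 2 = 1 → rot θ * w ∈ S3 := fun w hw => by
    change ‖rot θ * w‖ = 1
    rw [norm_rot_mul]
    exact (pow_eq_one_iff_of_nonneg (norm_nonneg _) two_ne_zero).mp hw
  have hflow : ∀ t w, rotFlow θ ε t (rot θ * w) = rot θ * baseFlow ε t w := fun t w => by
    rw [rotFlow, star_rot_mul_cancel]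
  have hinj : ∀ {v w : ℍ}, rot θ * v = rot θ * w ↔ v = w := fun {v w} =>
    ⟨fun h => by rw [← star_rot_mul_cancel θ v, h, star_rot_mul_cancel], fun h => by rw [h]⟩
  have hbase : ∀ t {w : ℍ}, ‖w‖ ^ 2 = 1 → ‖baseFlow ε t w‖ ^ 2 = 1 := fun t w hw => by
    rw [norm_baseFlow, hw]
  -- The level set is parametrised by unit quaternions up to sign, in the coordinates in which the
  -- flow is `baseFlow`.
  let P : ∀ w : ℍ, ‖w‖ ^ 2 = 1 → level θ ε := fun w hw =>
    ⟨coverDef θ ε (rot θ * w), coverDef_mem hε θ (hS w hw)⟩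
  have hP : ∀ {v w : ℍ} (hv : ‖v‖ ^ 2 = 1) (hw : ‖w‖ ^ 2 = 1),
      P v hv = P w hw ↔ v = w ∨ v = -w := fun {v w} hv hw => by
    rw [Subtype.ext_iff]
    change coverDef θ ε _ = coverDef θ ε _ ↔ _
    rw [coverDef_eq_iff hε θ (hS v hv) (hS w hw), hinj, ← mul_neg, hinj]
  have hψP : ∀ t {w : ℍ} (hw : ‖w‖ ^ 2 = 1), ψ t (P w hw) = P (baseFlow ε t w) (hbase t hw) :=
    fun t w hw => Subtype.ext <| by
      change (ψ t ⟨coverDef θ ε (rot θ * w), _⟩ : ℍ × ℍ) = coverDef θ ε (rot θ * baseFlow ε t w)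
      rw [hψ t _ (hS w hw), hflow]
  have hsurj : ∀ p, ∃ (w : ℍ) (hw : ‖w‖ ^ 2 = 1), p = P w hw := by
    rintro ⟨p, hp⟩
    obtain ⟨u, hu, rfl⟩ := exists_coverDef_eq hε θ hp
    have hu1 : ‖star (rot θ) * u‖ ^ 2 = 1 := by
      rw [norm_star_rot_mul, show ‖u‖ = 1 from hu, one_pow]
    refine ⟨star (rot θ) * u, hu1, Subtype.ext ?_⟩
    change _ = coverDef θ ε (rot θ * (star (rot θ) * u))
    rw [rot_mul_cancel]
  have n1 : ‖(1 : ℍ)‖ ^ 2 = 1 := by simp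
  have nj : ‖qj‖ ^ 2 = 1 := by rw [norm_sq_coord]; simp
  have hdist : ψ.orbit (P 1 n1) ≠ ψ.orbit (P qj nj) := fun h => by
    have h3 := ψ.mem_orbit_self (P 1 n1)
    rw [h, ψ.mem_orbit_iff] at h3
    obtain ⟨t, ht⟩ := h3
    rw [hψP t nj, hP (hbase t nj) n1] at ht
    rcases ht with ht | ht
    · have := congrArg (fun q : ℍ => q.re) ht
      simp [baseFlow] at this
    · have := congrArg (fun q : ℍ => q.re) ht
      simp [baseFlow] at this
  suffices h : periodicOrbits ψ = {ψ.orbit (P 1 n1), ψ.orbit (P qj nj)} by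
    rw [h, ncard_pair hdist]
  ext O
  constructor
  · rintro ⟨p, rfl, ⟨τ, hτ, hp⟩, -⟩
    obtain ⟨w, hw, rfl⟩ := hsurj p
    rw [hψP τ hw, hP (hbase τ hw) hw] at hp
    have hw1 := hw
    rw [norm_sq_coord] at hw1
    rcases baseFlow_periodic_of_irrational hε hirr hτ hp with ⟨ha, hb⟩ | ⟨ha, hb⟩
    · right
      obtain ⟨s, hc, hs⟩ := exists_angle (x := w.imJ) (y := w.imK) (by simpa [ha, hb] using hw1)
      refine orbit_eq_of_eq ψ (t := 2 * s / (1 - ε)) ?_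
      rw [hψP _ nj, hP hw (hbase _ nj)]
      left
      have e : (1 - ε) / 2 * (2 * s / (1 - ε)) = s := by field_simp
      ext <;> simp [baseFlow, ha, hb, hc, hs, e]
    · left
      obtain ⟨s, hc, hs⟩ := exists_angle (x := w.re) (y := w.imI) (by simpa [ha, hb] using hw1)
      refine orbit_eq_of_eq ψ (t := 2 * s / (1 + ε)) ?_
      rw [hψP _ n1, hP hw (hbase _ n1)]
      left
      have e : (1 + ε) / 2 * (2 * s / (1 + ε)) = s := by field_simp
      ext <;> simp [baseFlow, ha, hb, hc, hs, e]
  · have e : ∀ c s : ℝ, c ≠ 0 → c / 2 * (2 * s / c) = s := fun c s hc => by field_simp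
    rintro (rfl | rfl)
    · refine ⟨_, rfl, ⟨2 * (2 * π) / (1 + ε), by positivity, ?_⟩, 2 * (π / 2) / (1 + ε), ?_⟩
      · rw [hψP _ n1, hP (hbase _ n1) n1]
        left
        ext <;> simp [baseFlow, e _ _ h2.ne']
      · rw [hψP _ n1, ne_eq, hP (hbase _ n1) n1]
        rintro (h | h)
        · have := congrArg (fun q : ℍ => q.imI) h
          simp [baseFlow, e _ _ h2.ne'] at this
        · have := congrArg (fun q : ℍ => q.imI) h
          simp [baseFlow, e _ _ h2.ne'] at this
    · refine ⟨_, rfl, ⟨2 * (2 * π) / (1 - ε), by positivity, ?_⟩, 2 * (π / 2) / (1 - ε), ?_⟩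
      · rw [hψP _ nj, hP (hbase _ nj) nj]
        left
        ext <;> simp [baseFlow, e _ _ h1.ne']
      · rw [hψP _ nj, ne_eq, hP (hbase _ nj) nj]
        rintro (h | h)
        · have := congrArg (fun q : ℍ => q.imK) h
          simp [baseFlow, e _ _ h1.ne'] at this
        · have := congrArg (fun q : ℍ => q.imK) h
          simp [baseFlow, e _ _ h1.ne'] at this

/-! ### Zermelo navigation in a Euclidean space -/

section Zermelo

variable {E : Type*} [NormedAddCommGroup E] [InnerProductSpace ℝ E]

/-- The norm whose unit sphere is the round unit sphere, translated by `b`. -/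
def zermelo (b v : E) : ℝ :=
  (√(⟪v, b⟫ ^ 2 + (1 - ‖b‖ ^ 2) * ‖v‖ ^ 2) - ⟪v, b⟫) / (1 - ‖b‖ ^ 2)

section

variable {b : E} (hb : ‖b‖ < 1)
include hb

omit [InnerProductSpace ℝ E] in
theorem one_sub_norm_sq_pos : 0 < 1 - ‖b‖ ^ 2 := by
  nlinarith [norm_nonneg b]

theorem zermelo_disc_nonneg (v : E) : 0 ≤ ⟪v, b⟫ ^ 2 + (1 - ‖b‖ ^ 2) * ‖v‖ ^ 2 := by
  have := one_sub_norm_sq_pos hb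
  positivity

theorem zermelo_disc_pos {v : E} (hv : v ≠ 0) : 0 < ⟪v, b⟫ ^ 2 + (1 - ‖b‖ ^ 2) * ‖v‖ ^ 2 := by
  have := one_sub_norm_sq_pos hb
  have := norm_pos_iff.mpr hv
  positivity

theorem sqrt_zermelo_disc (v : E) : √(⟪v, b⟫ ^ 2 + (1 - ‖b‖ ^ 2) * ‖v‖ ^ 2) =
    (1 - ‖b‖ ^ 2) * zermelo b v + ⟪v, b⟫ := by
  rw [zermelo, mul_div_cancel₀ _ (one_sub_norm_sq_pos hb).ne']
  ring

theorem zermelo_nonneg (v : E) : 0 ≤ zermelo b v := by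
  have h := one_sub_norm_sq_pos hb
  refine div_nonneg (sub_nonneg.mpr (le_sqrt_of_sq_le ?_)) h.le
  nlinarith [mul_nonneg h.le (sq_nonneg ‖v‖)]

theorem zermelo_quadratic (v : E) :
    (1 - ‖b‖ ^ 2) * zermelo b v ^ 2 + 2 * ⟪v, b⟫ * zermelo b v = ‖v‖ ^ 2 := by
  have h := one_sub_norm_sq_pos hb
  have h1 := sq_sqrt (zermelo_disc_nonneg hb v)
  rw [sqrt_zermelo_disc hb] at h1
  exact mul_left_cancel₀ h.ne' (by linear_combination h1)

theorem norm_sub_zermelo_smul (v : E) : ‖v - zermelo b v • b‖ = zermelo b v := by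
  have h : ‖v - zermelo b v • b‖ ^ 2 = zermelo b v ^ 2 := by
    rw [norm_sub_sq_real, norm_smul, mul_pow, norm_eq_abs, sq_abs, inner_smul_right]
    linear_combination -(zermelo_quadratic hb v)
  exact (pow_left_inj₀ (norm_nonneg _) (zermelo_nonneg hb v) two_ne_zero).mp h

theorem zermelo_eq {v : E} {g : ℝ} (hg : 0 ≤ g) (h : ‖v - g • b‖ = g) : zermelo b v = g := by
  have hL := one_sub_norm_sq_pos hb
  have h1 : ‖v - g • b‖ ^ 2 = g ^ 2 := by rw [h]
  rw [norm_sub_sq_real, norm_smul, mul_pow, norm_eq_abs, sq_abs, inner_smul_right] at h1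
  -- This quantity is the square root of the discriminant up to sign; its nonnegativity selects the
  -- root that defines `zermelo`.
  have h2 : 0 ≤ (1 - ‖b‖ ^ 2) * g + ⟪v, b⟫ := by
    rcases hg.eq_or_lt with rfl | hg
    · simp only [zero_smul, sub_zero, norm_eq_zero] at h
      simp [h]
    · have h3 : 0 ≤ ((1 - ‖b‖ ^ 2) * g + 2 * ⟪v, b⟫) * g := by nlinarith [sq_nonneg ‖v‖]
      have h4 := nonneg_of_mul_nonneg_left h3 hg
      nlinarith [mul_nonneg hL.le hg.le]
  rw [zermelo, show ⟪v, b⟫ ^ 2 + (1 - ‖b‖ ^ 2) * ‖v‖ ^ 2 = ((1 - ‖b‖ ^ 2) * g + ⟪v, b⟫) ^ 2 by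
    linear_combination (1 - ‖b‖ ^ 2) * h1, sqrt_sq h2, add_sub_cancel_right,
    mul_div_cancel_left₀ _ hL.ne']

theorem zermelo_pos {v : E} (hv : v ≠ 0) : 0 < zermelo b v := by
  refine (zermelo_nonneg hb v).lt_of_ne' fun h => hv ?_
  have h1 := norm_sub_zermelo_smul hb v
  simpa [h] using h1

omit hb in
theorem zermelo_smul {c : ℝ} (hc : 0 ≤ c) (v : E) : zermelo b (c • v) = c * zermelo b v := by
  rw [zermelo, zermelo, real_inner_smul_left, norm_smul, norm_of_nonneg hc,
    show (c * ⟪v, b⟫) ^ 2 + (1 - ‖b‖ ^ 2) * (c * ‖v‖) ^ 2 =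
      c ^ 2 * (⟪v, b⟫ ^ 2 + (1 - ‖b‖ ^ 2) * ‖v‖ ^ 2) by ring,
    sqrt_mul (sq_nonneg c), sqrt_sq hc]
  ring

/-- The norm of a covector dual to `zermelo b` is the Euclidean norm plus the evaluation on `b`. -/
theorem inner_le_zermelo_mul (y v : E) : ⟪y, v⟫ ≤ zermelo b v * (‖y‖ + ⟪y, b⟫) := by
  have h := real_inner_le_norm y (v - zermelo b v • b)
  rw [norm_sub_zermelo_smul hb, inner_sub_right, inner_smul_right] at h
  linarith

theorem zermelo_add_of_norm_eq_one {n : E} (hn : ‖n‖ = 1) : zermelo b (n + b) = 1 :=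
  zermelo_eq hb zero_le_one (by rw [one_smul, add_sub_cancel_right, hn])

end

theorem contDiffAt_zermelo {b v : E} (hb : ‖b‖ < 1) (hv : v ≠ 0) {n : WithTop ℕ∞} :
    ContDiffAt ℝ n (fun p : E × E => zermelo p.1 p.2) (b, v) := by
  have h1 : ContDiffAt ℝ n (fun p : E × E => ⟪p.2, p.1⟫) (b, v) :=
    contDiffAt_snd.inner ℝ contDiffAt_fst
  have h2 : ContDiffAt ℝ n (fun p : E × E => 1 - ‖p.1‖ ^ 2) (b, v) :=
    contDiffAt_const.sub (contDiffAt_fst.norm_sq ℝ)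
  have h3 : ContDiffAt ℝ n (fun p : E × E => ‖p.2‖ ^ 2) (b, v) := contDiffAt_snd.norm_sq ℝ
  exact ((((h1.pow 2).add (h2.mul h3)).sqrt (zermelo_disc_pos hb hv).ne').sub h1).div h2
    (one_sub_norm_sq_pos hb).ne'

/-- The formula is what implicit differentiation of `‖v - g b‖² = g²` gives. The denominator is the
square root of the discriminant, hence positive. -/
theorem hasDerivAt_zermelo {b v : ℝ → E} {b' v' : E} {t : ℝ} (hb' : HasDerivAt b b' t)
    (hv' : HasDerivAt v v' t) (hb : ‖b t‖ < 1) (hv : v t ≠ 0) :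
    HasDerivAt (fun s => zermelo (b s) (v s))
      ((⟪v t - zermelo (b t) (v t) • b t, v'⟫ -
        zermelo (b t) (v t) * ⟪v t - zermelo (b t) (v t) • b t, b'⟫) /
        ((1 - ‖b t‖ ^ 2) * zermelo (b t) (v t) + ⟪v t, b t⟫)) t := by
  have h1 := hv'.inner ℝ hb'
  have h2 := (hb'.norm_sq).const_sub 1
  have hL := one_sub_norm_sq_pos hb
  have hD := zermelo_disc_pos hb hv
  have h3 := (((((h1.pow 2).add (h2.mul hv'.norm_sq)).sqrt hD.ne').sub h1).div h2 hL.ne')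
  refine h3.congr_deriv ?_
  have hq := zermelo_quadratic hb (v t)
  have hN := sqrt_pos.mpr hD
  simp only [Pi.add_apply, Pi.mul_apply, Pi.pow_apply, Pi.sub_apply]
  rw [sqrt_zermelo_disc hb] at hN ⊢
  rw [add_sub_cancel_right]
  set g := zermelo (b t) (v t)
  simp only [inner_sub_left, inner_smul_left, conj_trivial]
  rw [real_inner_comm v' (b t), ← hq]
  have hL' := hL.ne'
  have hN' := hN.ne'
  set L := 1 - ‖b t‖ ^ 2
  set N := L * g + ⟪v t, b t⟫ with hNdef
  rw [div_eq_div_iff (pow_ne_zero 2 hL') hN']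
  field_simp
  rw [hNdef]
  ring

/-- With `g₁` the derivative of the norm and `N` the discriminant root, the second derivative is
`(g₁² N + g (‖w - g₁ b‖² - g₁²)) / N`. The bracket is nonnegative by Cauchy-Schwarz. -/
theorem zermelo_energy_convex {b v w : E} (hb : ‖b‖ < 1) (hv : v ≠ 0) (hw : w ≠ 0) :
    0 < iteratedDeriv 2 (fun s : ℝ => zermelo b (v + s • w) ^ 2 / 2) 0 := by
  have hL := one_sub_norm_sq_pos hb
  let g : ℝ → ℝ := fun s => zermelo b (v + s • w)
  let N : ℝ → ℝ := fun s => (1 - ‖b‖ ^ 2) * g s + ⟪v + s • w, b⟫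
  let g₁ : ℝ → ℝ := fun s => (⟪v + s • w, w⟫ - ⟪w, b⟫ * g s) / N s
  have hline : ∀ s, HasDerivAt (fun s : ℝ => v + s • w) w s := fun s => by
    simpa using ((hasDerivAt_id s).smul_const w).const_add v
  have hg : ∀ s, v + s • w ≠ 0 → HasDerivAt g (g₁ s) s := fun s hs => by
    refine (hasDerivAt_zermelo (hasDerivAt_const s b) (hline s) hb hs).congr_deriv ?_
    simp only [inner_zero_right, mul_zero, sub_zero, inner_sub_left, inner_smul_left,
      conj_trivial, g₁, N, g]
    rw [real_inner_comm b w]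
    ring
  have hN : 0 < N 0 := by
    have h := sqrt_pos.mpr (zermelo_disc_pos hb (v := v + (0 : ℝ) • w) (by simpa using hv))
    rwa [sqrt_zermelo_disc hb] at h
  have h0 : v + (0 : ℝ) • w ≠ 0 := by simpa using hv
  have hg0 := hg 0 h0
  have hNd : HasDerivAt N ((1 - ‖b‖ ^ 2) * g₁ 0 + ⟪w, b⟫) 0 := by
    refine ((hg0.const_mul (1 - ‖b‖ ^ 2)).add
      ((hline 0).inner ℝ (hasDerivAt_const 0 b))).congr_deriv ?_
    simp
  have hg1 := (((hline 0).inner ℝ (hasDerivAt_const 0 w)).sub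
    (hg0.const_mul ⟪w, b⟫)).div hNd hN.ne'
  have hev : deriv (fun s : ℝ => zermelo b (v + s • w) ^ 2 / 2) =ᶠ[nhds 0]
      fun s => g s * g₁ s := by
    filter_upwards [(hline 0).continuousAt.eventually_ne h0] with s hs
    refine (((hg s hs).pow 2).div_const 2).deriv.trans ?_
    ring
  rw [iteratedDeriv_succ, iteratedDeriv_one, hev.deriv_eq,
    HasDerivAt.deriv (f := fun s => g s * g₁ s) (hg0.mul hg1)]
  have hrel : N 0 * g₁ 0 = ⟪v + (0 : ℝ) • w, w⟫ - ⟪w, b⟫ * g 0 := mul_div_cancel₀ _ hN.ne'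
  have hgp : 0 < g 0 := zermelo_pos hb h0
  -- Differentiating `‖v - g b‖² = g²` gives `⟪v - g b, w - g₁ b⟫ = g g₁`, and `‖v - g b‖ = g`.
  have hcs : g₁ 0 ^ 2 ≤ ‖w - g₁ 0 • b‖ ^ 2 := by
    have h1 := abs_real_inner_le_norm (v + (0 : ℝ) • w - g 0 • b) (w - g₁ 0 • b)
    rw [norm_sub_zermelo_smul hb, show ⟪v + (0 : ℝ) • w - g 0 • b, w - g₁ 0 • b⟫ = g 0 * g₁ 0 by
      simp only [inner_sub_left, inner_sub_right, inner_smul_left, inner_smul_right, conj_trivial,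
        real_inner_self_eq_norm_sq, inner_add_left] at hrel ⊢
      simp only [N, inner_add_left, inner_smul_left, conj_trivial] at hrel
      rw [real_inner_comm w b]
      linear_combination -hrel, abs_mul, abs_of_pos hgp] at h1
    have h2 := le_of_mul_le_mul_left h1 hgp
    rw [← sq_abs]
    exact pow_le_pow_left₀ (abs_nonneg _) h2 2
  have hnorm : ‖w - g₁ 0 • b‖ ^ 2 = ‖w‖ ^ 2 - 2 * g₁ 0 * ⟪w, b⟫ + g₁ 0 ^ 2 * ‖b‖ ^ 2 := by
    rw [norm_sub_sq_real, norm_smul, mul_pow, norm_eq_abs, sq_abs, inner_smul_right]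
    ring
  have hfin : 0 < g₁ 0 ^ 2 * N 0 + g 0 * (‖w - g₁ 0 • b‖ ^ 2 - g₁ 0 ^ 2) := by
    -- Strict positivity comes from `g₁² N`, except where `g₁` vanishes; there it comes from `‖w‖²`.
    rcases eq_or_ne (g₁ 0) 0 with h | h
    · rw [h]
      simpa using mul_pos hgp (pow_pos (norm_pos_iff.mpr hw) 2)
    · have h1 : 0 < g₁ 0 ^ 2 * N 0 := by positivity
      nlinarith [mul_nonneg hgp.le (sub_nonneg.mpr hcs)]
  refine pos_of_mul_pos_left (b := N 0) (hfin.trans_eq ?_) hN.le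
  simp only [Pi.sub_apply]
  rw [hnorm, ← hrel]
  simp only [inner_zero_right, zero_add, real_inner_self_eq_norm_sq]
  field_simp
  ring

end Zermelo

/-! ### The Randers metric -/

/-- The vector field `x ↦ -ε i × x`. -/
def wind (ε : ℝ) : ℍ →L[ℝ] ℍ :=
  (-(ε / 2)) • (ContinuousLinearMap.mul ℝ ℍ qi - (ContinuousLinearMap.mul ℝ ℍ).flip qi)

theorem wind_apply (ε : ℝ) (x : ℍ) : wind ε x = -(ε • cross qi x) := by
  change (-(ε / 2)) • (qi * x - x * qi) = -(ε • ((1 / 2 : ℝ) • (qi * x - x * qi)))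
  rw [smul_smul, ← neg_smul]
  congr 1
  ring

theorem wind_eq (ε : ℝ) (x : ℍ) : wind ε x = quat 0 0 (ε * x.imK) (-(ε * x.imJ)) := by
  rw [wind_apply, cross_eq]
  ext <;> simp

theorem inner_wind_self (ε : ℝ) (x : ℍ) : ⟪x, wind ε x⟫ = 0 := by
  rw [wind_eq, inner_coord]
  simp
  ring

theorem wind_mem (ε : ℝ) (x : ℍ) : wind ε x ∈ TS2 x :=
  ⟨by rw [wind_eq, quat_re], inner_wind_self ε x⟩

theorem norm_wind_lt_one {ε : ℝ} (hε : ε ∈ Ico (0 : ℝ) 1) {x : ℍ} (hx : x ∈ S2) :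
    ‖wind ε x‖ < 1 := by
  have h1 : ‖wind ε x‖ ^ 2 ≤ ε ^ 2 * ‖x‖ ^ 2 := by
    rw [wind_eq, norm_sq_coord, norm_sq_coord]
    simp only [quat_re, quat_imI, quat_imJ, quat_imK]
    nlinarith [mul_nonneg (sq_nonneg ε) (sq_nonneg x.re), mul_nonneg (sq_nonneg ε) (sq_nonneg x.imI)]
  rw [hx.2] at h1
  have h2 : ε ^ 2 < 1 := by nlinarith [hε.1, hε.2]
  exact (sq_lt_one_iff₀ (norm_nonneg _)).mp (by linarith)

/-- The dual norm is `y ↦ ‖y‖ + ⟪y, wind ε x⟫`. -/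
def randers (ε : ℝ) (x v : ℍ) : ℝ := zermelo (wind ε x) v

theorem TS2_smul {x v : ℍ} (hv : v ∈ TS2 x) (c : ℝ) : c • v ∈ TS2 x :=
  ⟨by simp [hv.1], by rw [inner_smul_right, hv.2, mul_zero]⟩

theorem TS2_add {x v w : ℍ} (hv : v ∈ TS2 x) (hw : w ∈ TS2 x) : v + w ∈ TS2 x :=
  ⟨by simp [hv.1, hw.1], by rw [inner_add_right, hv.2, hw.2, add_zero]⟩

theorem TS2_sub {x v w : ℍ} (hv : v ∈ TS2 x) (hw : w ∈ TS2 x) : v - w ∈ TS2 x :=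
  ⟨by simp [hv.1, hw.1], by rw [inner_sub_right, hv.2, hw.2, sub_zero]⟩

theorem contDiffAt_randers {ε : ℝ} {x v : ℍ} (hx : ‖wind ε x‖ < 1) (hv : v ≠ 0)
    {n : WithTop ℕ∞} : ContDiffAt ℝ n (fun p : ℍ × ℍ => randers ε p.1 p.2) (x, v) :=
  (contDiffAt_zermelo hx hv).comp (x, v)
    (((wind ε).contDiff.contDiffAt.comp (x, v) contDiffAt_fst).prodMk contDiffAt_snd)

theorem isFinsler_randers {ε : ℝ} (hε : ε ∈ Ico (0 : ℝ) 1) : IsFinsler (randers ε) where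
  smooth := by
    refine ⟨{p | ‖wind ε p.1‖ < 1 ∧ p.2 ≠ 0}, ?_, fun p hp => ⟨norm_wind_lt_one hε hp.1, hp.2.2⟩,
      fun p hp => (contDiffAt_randers hp.1 hp.2).contDiffWithinAt⟩
    exact (isOpen_lt ((wind ε).continuous.comp continuous_fst).norm continuous_const).inter
      (isOpen_compl_singleton.preimage continuous_snd)
  pos x hx v _ hv0 := zermelo_pos (norm_wind_lt_one hε hx) hv0
  homogeneous x _ v _ c hc := zermelo_smul hc v
  convex x hx v _ hv0 w _ hw0 := zermelo_energy_convex (norm_wind_lt_one hε hx) hv0 hw0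

theorem isRanders_randers {ε : ℝ} (hε : ε ∈ Ico (0 : ℝ) 1) : IsRanders (randers ε) := by
  have ho : IsOpen {x : ℍ | ‖wind ε x‖ < 1} :=
    isOpen_lt (wind ε).continuous.norm continuous_const
  have hW : ContDiff ℝ ∞ (wind ε) := (wind ε).contDiff
  have hL : ContDiff ℝ ∞ (fun x => 1 - ‖wind ε x‖ ^ 2) := contDiff_const.sub (hW.norm_sq ℝ)
  have hi : ContDiff ℝ ∞ (fun x => innerSL ℝ (wind ε x)) :=
    (innerSL ℝ : ℍ →L[ℝ] ℍ →L[ℝ] ℝ).contDiff.comp hW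
  have hinv : ContDiffOn ℝ ∞ (fun x => (1 - ‖wind ε x‖ ^ 2)⁻¹) {x : ℍ | ‖wind ε x‖ < 1} :=
    hL.contDiffOn.inv fun x hx => (one_sub_norm_sq_pos hx).ne'
  -- The formula for `zermelo` splits into its root, which is a Riemannian norm, and its linear
  -- term. With `L = 1 - ‖b‖²` these are `(L ⟪v, w⟫ + ⟪v, b⟫ ⟪w, b⟫) / L²` and `-⟪b, ·⟫ / L`.
  refine ⟨fun x => ((1 - ‖wind ε x‖ ^ 2)⁻¹ ^ 2) • ((1 - ‖wind ε x‖ ^ 2) •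
      ContinuousLinearMap.id ℝ ℍ + (innerSL ℝ (wind ε x)).smulRight (wind ε x)),
    fun x => innerSL ℝ ((-(1 - ‖wind ε x‖ ^ 2)⁻¹) • wind ε x),
    ⟨_, ho, fun x hx => norm_wind_lt_one hε hx,
      (hinv.pow 2).smul ((hL.smul contDiff_const).add (hi.smulRight hW)).contDiffOn⟩,
    ⟨_, ho, fun x hx => norm_wind_lt_one hε hx, (innerSL ℝ : ℍ →L[ℝ] ℍ →L[ℝ] ℝ).contDiff.comp_contDiffOn
        (hinv.neg.smul hW.contDiffOn)⟩, fun x hx => ?_⟩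
  have hb := norm_wind_lt_one hε hx
  set b := wind ε x
  have hpos := one_sub_norm_sq_pos hb
  have hh : ∀ v w : ℍ, ⟪(((1 - ‖b‖ ^ 2)⁻¹ ^ 2) • ((1 - ‖b‖ ^ 2) •
      ContinuousLinearMap.id ℝ ℍ + (innerSL ℝ b).smulRight b)) v, w⟫ =
      ((1 - ‖b‖ ^ 2) * ⟪v, w⟫ + ⟪v, b⟫ * ⟪w, b⟫) / (1 - ‖b‖ ^ 2) ^ 2 := fun v w => by
    change ⟪((1 - ‖b‖ ^ 2)⁻¹ ^ 2) • ((1 - ‖b‖ ^ 2) • v + ⟪b, v⟫ • b), w⟫ = _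
    rw [real_inner_smul_left, inner_add_left, real_inner_smul_left, real_inner_smul_left,
      real_inner_comm w b, real_inner_comm v b]
    field_simp
  refine ⟨fun v _ w _ => ?_, fun v _ hv => ?_, fun v _ => ?_⟩
  · rw [hh, hh, real_inner_comm v w]
    ring
  · have := norm_pos_iff.mpr hv
    rw [hh, real_inner_self_eq_norm_sq, ← sq]
    positivity
  · rw [hh, real_inner_self_eq_norm_sq, sqrt_div' _ (sq_nonneg _), sqrt_sq hpos.le]
    change zermelo b v = _ + ⟪(-(1 - ‖b‖ ^ 2)⁻¹) • b, v⟫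
    rw [zermelo, real_inner_smul_left, real_inner_comm v b, ← sq, add_comm (⟪v, b⟫ ^ 2)]
    ring

/-! ### Derivatives on the unit tangent bundle -/

section

variable {ε : ℝ} {x v : ℍ} (hx : ‖wind ε x‖ < 1) (h1 : randers ε x v = 1)
include hx h1

omit hx in
theorem ne_zero_of_randers_eq_one : v ≠ 0 := by
  rintro rfl
  simp [randers, zermelo] at h1

theorem norm_sub_wind : ‖v - wind ε x‖ = 1 := by
  have h := norm_sub_zermelo_smul hx v
  rwa [show zermelo (wind ε x) v = 1 from h1, one_smul] at h

theorem hasDerivAt_randers_sq {a c : ℝ → ℍ} {a' c' : ℍ} (ha : HasDerivAt a a' 0)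
    (hc : HasDerivAt c c' 0) (ha0 : a 0 = x) (hc0 : c 0 = v) :
    HasDerivAt (fun s => randers ε (a s) (c s) ^ 2 / 2)
      ((⟪v - wind ε x, c'⟫ - ⟪v - wind ε x, wind ε a'⟫) / (1 + ⟪v - wind ε x, wind ε x⟫)) 0 := by
  have hv := ne_zero_of_randers_eq_one h1
  have h := (((hasDerivAt_zermelo ((wind ε).hasFDerivAt.comp_hasDerivAt (0 : ℝ) ha) hc
    (by simpa [ha0] using hx) (by simpa [hc0] using hv)).pow 2).div_const 2)
  refine h.congr_deriv ?_
  simp only [Function.comp_apply, ha0, hc0, show zermelo (wind ε x) v = 1 from h1, one_smul,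
    inner_sub_left, real_inner_self_eq_norm_sq]
  ring

theorem fderiv_randers_right (w : ℍ) : fderiv ℝ (fun v => randers ε x v ^ 2 / 2) v w =
    ⟪v - wind ε x, w⟫ / (1 + ⟪v - wind ε x, wind ε x⟫) := by
  have hv := ne_zero_of_randers_eq_one h1
  have hg : DifferentiableAt ℝ (fun v => randers ε x v) v :=
    ((contDiffAt_randers (n := 1) hx hv).comp (g := fun p : ℍ × ℍ => randers ε p.1 p.2)
      (f := fun v => (x, v)) v (contDiffAt_const.prodMk contDiffAt_id)).differentiableAt one_ne_zero
  have hd : DifferentiableAt ℝ (fun v => randers ε x v ^ 2 / 2) v := by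
    simp only [div_eq_mul_inv]
    exact (hg.pow 2).mul_const _
  have hl := hasDerivAt_randers_sq hx h1 (a := fun _ => x) (c := fun t => v + t • w)
    (hasDerivAt_const 0 x) (hasDerivAt_line v w) rfl (by simp only [zero_smul, add_zero])
  rw [fderiv_eq_of_line hd hl, map_zero, inner_zero_right, sub_zero]

theorem fderiv_randers_left (w : ℍ) : fderiv ℝ (fun x => randers ε x v ^ 2 / 2) x w =
    -(⟪v - wind ε x, wind ε w⟫ / (1 + ⟪v - wind ε x, wind ε x⟫)) := by
  have hv := ne_zero_of_randers_eq_one h1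
  have hg : DifferentiableAt ℝ (fun x => randers ε x v) x :=
    ((contDiffAt_randers (n := 1) hx hv).comp (g := fun p : ℍ × ℍ => randers ε p.1 p.2)
      (f := fun x => (x, v)) x (contDiffAt_id.prodMk contDiffAt_const)).differentiableAt one_ne_zero
  have hd : DifferentiableAt ℝ (fun x => randers ε x v ^ 2 / 2) x := by
    simp only [div_eq_mul_inv]
    exact (hg.pow 2).mul_const _
  have hl := hasDerivAt_randers_sq hx h1 (a := fun t => x + t • w) (c := fun _ => v)
    (hasDerivAt_line x w) (hasDerivAt_const 0 v) (by simp only [zero_smul, add_zero]) rfl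
  rw [fderiv_eq_of_line hd hl, inner_zero_right]
  ring

end

/-! ### The geodesic flow -/

section

variable {θ κ : ℝ} (hc : cos θ = 0) (hs : sin θ = κ) (hκ : κ ^ 2 = 1)

include hκ in
theorem abs_eq_one_of_sq : |κ| = 1 :=
  (pow_eq_one_iff_of_nonneg (abs_nonneg κ) two_ne_zero).mp (by rw [sq_abs, hκ])

theorem inner_cross_qi (x y : ℍ) : ⟪y, cross qi x⟫ = (cross x y).imI := by
  rw [cross_eq, cross_eq, inner_coord]
  simp
  ring

include hc hs in
theorem ham_eq_norm_sub (ε : ℝ) (p : ℍ × ℍ) :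
    ham θ ε p = ‖p.2‖ - ε * ⟪κ • p.2, cross qi p.1⟫ := by
  rw [ham, hc, hs, real_inner_smul_left, inner_cross_qi]
  ring

include hc hs in
theorem ham_eq_norm_add (ε : ℝ) (p : ℍ × ℍ) :
    ham θ ε p = ‖p.2‖ + κ * ⟪p.2, wind ε p.1⟫ := by
  rw [ham_eq_norm_sub hc hs, wind_apply, inner_neg_right, inner_smul_right, real_inner_smul_left]
  ring

include hc hs in
theorem fderiv_ham (ε : ℝ) {p : ℍ × ℍ} (hp : p.2 ≠ 0) (w : ℍ × ℍ) : fderiv ℝ (ham θ ε) p w =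
    ⟪p.2, w.2⟫ / ‖p.2‖ + κ * (⟪p.2, wind ε w.1⟫ + ⟪w.2, wind ε p.1⟫) := by
  refine fderiv_eq_of_line (differentiableAt_ham θ ε hp) ?_
  simp only [ham_eq_norm_add hc hs]
  have h1 := hasDerivAt_line p.1 w.1
  have h2 := hasDerivAt_line p.2 w.2
  have h3 := (h2.norm_sq).sqrt (by simpa using hp)
  simp only [sqrt_sq (norm_nonneg _)] at h3
  refine (h3.add ((h2.inner ℝ ((wind ε).hasFDerivAt.comp_hasDerivAt (0 : ℝ) h1)).const_mul
    κ)).congr_deriv ?_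
  simp
  ring

include hc hs hκ in
theorem hamiltonianVector_fst (ε : ℝ) {p X : ℍ × ℍ} (hp : p ∈ cotS2)
    (hX : IsHamiltonianVector TcotS2 (omegaTheta θ) (ham θ ε) p X) :
    X.1 = (κ * ‖p.2‖⁻¹) • p.2 + wind ε p.1 := by
  have hd : X.1 - ((κ * ‖p.2‖⁻¹) • p.2 + wind ε p.1) ∈ TS2 p.1 :=
    TS2_sub hX.1.1 (TS2_add (TS2_smul hp.2.1 _) (wind_mem ε p.1))
  set d := X.1 - ((κ * ‖p.2‖⁻¹) • p.2 + wind ε p.1) with hd'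
  -- Testing against vertical vectors isolates the base component of the Hamiltonian vector. The
  -- error `d` is itself used as test vector and turns out to have norm zero.
  have h := hX.2 (0, d) ⟨⟨by simp, by simp⟩, hd.1, by simpa using hd.2⟩
  rw [omegaTheta, hc, hs, dForm_liouville, fderiv_ham hc hs ε hp.2.2] at h
  simp only [inner_zero_right, map_zero, zero_sub, zero_mul, add_zero, zero_add] at h
  have h2 : ⟪d, d⟫ = 0 := by
    conv_lhs => rw [hd', ← hd']
    rw [inner_sub_right, inner_add_right, inner_smul_right, real_inner_comm p.2 d]
    linear_combination -κ * h + (⟪d, wind ε p.1⟫ - ⟪d, X.1⟫) * hκ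
  exact sub_eq_zero.mp (inner_self_eq_zero.mp h2)

include hc hs hκ in
theorem hamiltonianVector_snd (ε : ℝ) {p X : ℍ × ℍ} (hp : p ∈ cotS2)
    (hX : IsHamiltonianVector TcotS2 (omegaTheta θ) (ham θ ε) p X) {w : ℍ} (hw : w ∈ TS2 p.1) :
    ⟪X.2, w⟫ = -⟪p.2, wind ε w⟫ := by
  -- The fibre component along `x` is the correction that makes this lift of `w` tangent to the
  -- cotangent bundle.
  have h := hX.2 (w, (-⟪w, p.2⟫) • p.1) ⟨hw, by simp [hp.1.1], by
    rw [inner_smul_right, real_inner_self_eq_norm_sq, hp.1.2]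
    ring⟩
  rw [omegaTheta, hc, hs, dForm_liouville, fderiv_ham hc hs ε hp.2.2] at h
  simp only [real_inner_smul_left, inner_smul_right, hX.1.1.2, inner_wind_self,
    real_inner_comm p.1 p.2, hp.2.1.2] at h
  linear_combination κ * h - (⟪X.2, w⟫ + ⟪p.2, wind ε w⟫) * hκ

/-- The unit tangent vector with Legendre transform `κ • p.2`. -/
def legendreInv (κ ε : ℝ) (p : ℍ × ℍ) : ℍ := (κ * ‖p.2‖⁻¹) • p.2 + wind ε p.1

include hκ in
theorem randers_legendreInv {ε : ℝ} (hε : ε ∈ Ico (0 : ℝ) 1) {p : ℍ × ℍ} (hp : p ∈ cotS2) :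
    randers ε p.1 (legendreInv κ ε p) = 1 := by
  have h0 := norm_ne_zero_iff.mpr hp.2.2
  refine zermelo_add_of_norm_eq_one (norm_wind_lt_one hε hp.1) ?_
  rw [norm_smul, norm_mul, norm_inv, norm_norm, mul_assoc, inv_mul_cancel₀ h0, mul_one,
    norm_eq_abs, abs_eq_one_of_sq hκ]

include hc hs in
-- On the level set the normalising denominator equals `‖y‖⁻¹`, because `‖y‖ + κ ⟪y, wind⟫ = 1`.
-- Hence the Legendre transform returns `κ y` with its correct length.
theorem inner_legendreInv {ε : ℝ} {p : ℍ × ℍ} (hp : p ∈ level θ ε) (w : ℍ) :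
    ⟪legendreInv κ ε p - wind ε p.1, w⟫ / (1 + ⟪legendreInv κ ε p - wind ε p.1, wind ε p.1⟫) =
      ⟪κ • p.2, w⟫ := by
  have h0 := norm_ne_zero_iff.mpr hp.1.2.2
  have h1 := hp.2
  rw [ham_eq_norm_add hc hs] at h1
  have h2 : 1 + κ * ‖p.2‖⁻¹ * ⟪p.2, wind ε p.1⟫ = ‖p.2‖⁻¹ := by
    field_simp
    exact h1
  rw [legendreInv, add_sub_cancel_right, real_inner_smul_left, real_inner_smul_left, h2,
    real_inner_smul_left]
  field_simp

include hc hs hκ in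
theorem isLUB_randers {ε : ℝ} (hε : ε ∈ Ico (0 : ℝ) 1) {p : ℍ × ℍ} (hp : p ∈ cotS2) :
    IsLUB {r | ∃ v ∈ TS2 p.1, randers ε p.1 v ≤ 1 ∧ r = ⟪κ • p.2, v⟫} (ham θ ε p) := by
  have hb := norm_wind_lt_one hε hp.1
  have h0 := norm_ne_zero_iff.mpr hp.2.2
  have hκ1 : |κ| = 1 := abs_eq_one_of_sq hκ
  have hn : ‖κ • p.2‖ = ‖p.2‖ := by rw [norm_smul, norm_eq_abs, hκ1, one_mul]
  have hH : ham θ ε p = ‖κ • p.2‖ + ⟪κ • p.2, wind ε p.1⟫ := by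
    rw [ham_eq_norm_add hc hs, hn, real_inner_smul_left]
  have hH0 : 0 ≤ ham θ ε p := by
    have h := (abs_le.mp (abs_real_inner_le_norm (κ • p.2) (wind ε p.1))).1
    rw [hH]
    nlinarith [norm_nonneg (κ • p.2)]
  -- The supremum is attained at the unit vector whose translate by the wind points along `κ y`.
  refine IsGreatest.isLUB ⟨⟨legendreInv κ ε p, TS2_add (TS2_smul hp.2.1 _) (wind_mem ε p.1),
    (randers_legendreInv hκ hε hp).le, ?_⟩, ?_⟩
  · rw [legendreInv, inner_add_right, hH, hn, inner_smul_right, real_inner_smul_left p.2 p.2 κ,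
      real_inner_self_eq_norm_sq]
    congr 1
    field_simp
    exact hκ.symm
  · rintro r ⟨v, hv, hv1, rfl⟩
    refine (inner_le_zermelo_mul hb _ _).trans ?_
    rw [← hH]
    exact mul_le_of_le_one_left hH0 hv1

theorem contDiff_baseFlow (ε : ℝ) (u : ℍ) {n : WithTop ℕ∞} :
    ContDiff ℝ n (fun t => baseFlow ε t u) := by
  refine contDiff_iff_contDiffAt.mpr fun t => contDiffAt_quat ?_ ?_ ?_ ?_ <;> fun_prop

theorem contDiff_coverDef_rotFlow {ε : ℝ} (hε : ε ∈ Ico (0 : ℝ) 1) (θ : ℝ) {u : ℍ} (hu : u ∈ S3)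
    {n : WithTop ℕ∞} : ContDiff ℝ n (fun t => coverDef θ ε (rotFlow θ ε t u)) := by
  refine contDiff_iff_contDiffAt.mpr fun t => ?_
  have h : ContDiffAt ℝ n (fun t => rotFlow θ ε t u) t :=
    contDiffAt_const.mul (contDiff_baseFlow ε _).contDiffAt
  exact (contDiffAt_coverDef hε θ (ne_zero_of_mem_S3 (rotFlow_mem θ ε t hu))).comp (g := coverDef θ ε)
    (f := fun t => rotFlow θ ε t u) t h

include hc hs hκ in
theorem isGeodesicFlow_randers {ε : ℝ} (hε : ε ∈ Ico (0 : ℝ) 1) {ψ : Flow ℝ (level θ ε)}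
    (hψ : ∀ t u (hu : u ∈ S3), (ψ t ⟨coverDef θ ε u, coverDef_mem hε θ hu⟩ : ℍ × ℍ) =
      coverDef θ ε (rotFlow θ ε t u)) :
    IsGeodesicFlow (randers ε) κ (level θ ε) ψ := by
  constructor
  · rintro ⟨p, hp⟩
    obtain ⟨u, hu, rfl⟩ := exists_coverDef_eq hε θ hp
    set c : ℝ → ℍ × ℍ := fun t => coverDef θ ε (rotFlow θ ε t u) with hcdef
    have hl : ∀ t, c t ∈ level θ ε := fun t => coverDef_mem hε θ (rotFlow_mem θ ε t hu)
    have hb : ∀ t, ‖wind ε (c t).1‖ < 1 := fun t => norm_wind_lt_one hε (hl t).1.1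
    have hder : ∀ t, deriv (fun t => (c t).1) t = legendreInv κ ε (c t) := fun t => by
      obtain ⟨X, hX, hXH⟩ := hasDerivAt_coverDef_rotFlow hε θ t hu
      rw [legendreInv, ← hamiltonianVector_fst hc hs hκ ε (hl t).1 hXH]
      exact ((ContinuousLinearMap.fst ℝ ℍ ℍ).hasFDerivAt.comp_hasDerivAt t hX).deriv
    have h1 : ∀ t, randers ε (c t).1 (legendreInv κ ε (c t)) = 1 := fun t =>
      randers_legendreInv hκ hε (hl t).1
    have hleg : ∀ t w, fderiv ℝ (fun v => randers ε (c t).1 v ^ 2 / 2)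
        (legendreInv κ ε (c t)) w = ⟪κ • (c t).2, w⟫ := fun t w => by
      rw [fderiv_randers_right (hb t) (h1 t), inner_legendreInv hc hs (hl t)]
    refine ⟨fun t => (c t).1, ⟨(contDiff_coverDef_rotFlow hε θ hu).fst, fun t => (hl t).1.1,
      fun t => ?_, fun t w hw => ?_⟩, fun t => ⟨?_, by rw [hψ t u hu], fun w _ => ?_⟩⟩
    · rw [hder]
      exact ne_zero_of_randers_eq_one (h1 t)
    · simp only [hder, hleg]
      obtain ⟨X, hX, hXH⟩ := hasDerivAt_coverDef_rotFlow hε θ t hu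
      -- The momentum `∂_v(½ G²)` is `κ y`, so the Euler-Lagrange equation is exactly the fibre half
      -- of Hamilton's equations, `hamiltonianVector_snd`.
      rw [fderiv_randers_left (hb t) (h1 t), inner_legendreInv hc hs (hl t)]
      have hX2 : HasDerivAt (fun s => (c s).2) X.2 t :=
        (ContinuousLinearMap.snd ℝ ℍ ℍ).hasFDerivAt.comp_hasDerivAt t hX
      refine ((hX2.const_smul κ).inner ℝ (hasDerivAt_const t w)).congr_deriv ?_
      rw [inner_zero_right, zero_add, real_inner_smul_left, real_inner_smul_left,
        hamiltonianVector_snd hc hs hκ ε (hl t).1 hXH hw, mul_neg]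
    · rw [hder]
      exact h1 t
    · rw [hψ t u hu, hder, hleg]
  · intro x hx v hv h1
    have hb := norm_wind_lt_one hε hx
    have hn := norm_sub_wind hb h1
    set n := v - wind ε x with hndef
    have hpos : 0 < 1 + ⟪n, wind ε x⟫ := by
      have h := (abs_le.mp (abs_real_inner_le_norm n (wind ε x))).1
      rw [hn] at h
      linarith
    have hκ1 : |κ| = 1 := abs_eq_one_of_sq hκ
    have hκ0 : κ ≠ 0 := fun h => by simp [h] at hκ
    have hn0 : n ≠ 0 := norm_ne_zero_iff.mp (by rw [hn]; exact one_ne_zero)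
    have hnT : n ∈ TS2 x := TS2_sub hv (wind_mem ε x)
    -- Conversely, `v` minus the wind is a unit vector `n`, and rescaling `κ n` by this factor puts
    -- the covector on the level set.
    refine ⟨⟨(x, (κ * (1 + ⟪n, wind ε x⟫)⁻¹) • n), ⟨hx, TS2_smul hnT _,
      smul_ne_zero (mul_ne_zero hκ0 (inv_pos.mpr hpos).ne') hn0⟩, ?_⟩, rfl, fun w _ => ?_⟩
    · rw [ham_eq_norm_add hc hs]
      simp only [norm_smul, norm_mul, norm_eq_abs κ, hκ1, norm_inv, norm_of_nonneg hpos.le, hn,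
        real_inner_smul_left]
      field_simp
      rw [hκ]
      ring
    · rw [fderiv_randers_right hb h1]
      simp only [real_inner_smul_left, ← hndef]
      field_simp
      rw [hκ, one_mul]

end

end QuatMagnetic

end

theorem theorem1 :
    -- the contact forms, the circle action and its effect on `α_i`
    IsContactForm S3 TS3 (alpha qi) ∧ IsContactForm S3 TS3 (alpha qj) ∧
    (∀ θ, IsContactForm S3 TS3 (alphaTheta θ)) ∧
    ((∀ θ, ∀ u ∈ S3, rot θ * u ∈ S3) ∧ (∀ u, rot 0 * u = u) ∧
      (∀ θ θ' u, rot (θ + θ') * u = rot θ * (rot θ' * u)) ∧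
      (∀ θ u, rot (θ + 4 * π) * u = rot θ * u)) ∧
    (∀ θ, ∀ u ∈ S3, ∀ v ∈ TS3 u, pushRot θ (alpha qi) u v = alphaTheta θ u v) ∧
    -- the Reeb flow of `α^θ` is `4π`-periodic and doubly covers the Hamiltonian flow of `ω^θ`,
    -- which for `sin θ ≠ 0` is a magnetic flow up to a constant time change
    (∀ θ, IsNondegenerate cotS2 TcotS2 (omegaTheta θ)) ∧
    (∀ θ, ∃ (φ : Flow ℝ S3) (ψ : Flow ℝ unitCot),
      IsReebFlow S3 TS3 (alphaTheta θ) φ ∧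
      (∀ u, φ (4 * π) u = u ∧ ∀ t, 0 < t → t < 4 * π → φ t u ≠ u) ∧
      IsHamiltonianFlow unitCot TcotS2 (omegaTheta θ) kinetic ψ ∧
      DoublyCovers Phi S3 TS3 unitCot φ ψ ∧
      (sin θ ≠ 0 → ∃ ψ' : Flow ℝ unitCot, (∀ t p, ψ' t p = ψ (t / sin θ) p) ∧
        IsHamiltonianFlow unitCot TcotS2 (magneticForm (-cot θ)) kinetic ψ')) ∧
    -- the deformation through contact forms, and its rotations
    ((∀ u ∈ S3, ∀ v ∈ TS3 u, alphaDef 0 u v = alpha qi u v) ∧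
      ContDiffOn ℝ ∞ (fun q : ℝ × ℍ => alphaDef q.1 q.2) (Ico 0 1 ×ˢ univ) ∧
      (∀ ε ∈ Ico (0 : ℝ) 1, IsContactForm S3 TS3 (alphaDef ε)) ∧
      (∀ θ, ∀ ε ∈ Ico (0 : ℝ) 1, IsContactForm S3 TS3 (alphaThetaDef θ ε) ∧
        ∀ u ∈ S3, ∀ v ∈ TS3 u, alphaThetaDef (θ + 2 * π) ε u v = alphaThetaDef θ ε u v)) ∧
    -- the perturbed Hamiltonian functions
    (∀ θ, SmoothNear (univ ×ˢ cotS2) (fun q : ℝ × (ℍ × ℍ) => ham θ q.1 q.2) ∧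
      (∀ p ∈ cotS2, ham θ 0 p = ‖p.2‖) ∧
      ∀ ε, ∀ u : ℍ, u ≠ 0 → PhiExt u ∈ cotS2 ∧
        ham θ ε (PhiExt u) = quadHam ε (star (rot θ) * u)) ∧
    ∃ ε₀ : ℝ, 0 < ε₀ ∧ ∀ θ, ∀ ε ∈ Ico (0 : ℝ) 1,
      ∃ (φ : Flow ℝ S3) (ψ : Flow ℝ (level θ ε)),
        -- (i)
        IsReebFlow S3 TS3 (alphaThetaDef θ ε) φ ∧
        IsHamiltonianFlow (level θ ε) TcotS2 (omegaTheta θ) (ham θ ε) ψ ∧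
        DoublyCovers (coverDef θ ε) S3 TS3 (level θ ε) φ ψ ∧
        -- (ii)
        (Irrational ε → (periodicOrbits ψ).ncard = 2) ∧
        -- (iii)
        ((∃ n : ℤ, θ = π / 2 + n * π) → ε < ε₀ →
          (∀ p ∈ cotS2, ham θ ε p = ‖p.2‖ - ε * ⟪sin θ • p.2, cross qi p.1⟫) ∧
          ∃ G : ℍ → ℍ → ℝ, IsFinsler G ∧ IsRanders G ∧
            (∀ p ∈ cotS2, IsLUB {r | ∃ v ∈ TS2 p.1, G p.1 v ≤ 1 ∧ r = ⟪sin θ • p.2, v⟫}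
              (ham θ ε p)) ∧
            IsGeodesicFlow G (sin θ) (level θ ε) ψ) := by
  have hi : IsContactForm S3 TS3 (alpha qi) := by
    have h := isContactForm_alphaTheta 0
    rwa [alphaTheta_zero] at h
  have hj : IsContactForm S3 TS3 (alpha qj) := by
    have h := isContactForm_alphaTheta (π / 2)
    rwa [alphaTheta_pi_div_two] at h
  refine ⟨hi, hj, isContactForm_alphaTheta, ⟨fun θ u hu => (norm_rot_mul θ u).trans hu,
    fun u => by rw [rot_zero, one_mul], fun θ θ' u => by rw [rot_add, mul_assoc],
    fun θ u => by rw [rot_add_four_pi]⟩, fun θ u _ v _ => by rw [pushRot_alpha_qi],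
    isNondegenerate_omegaTheta, exists_unperturbed_flow,
    ⟨fun u _ v _ => by rw [alphaDef_zero], contDiffOn_alphaDef, fun ε hε => ?_,
      fun θ ε hε => ⟨isContactForm_alphaThetaDef θ hε,
        fun u _ v _ => by rw [alphaThetaDef_add_two_pi]⟩⟩,
    fun θ => ⟨smoothNear_ham θ, fun p _ => by rw [ham, zero_mul, add_zero],
      fun ε u hu => ⟨PhiExt_mem hu, ham_PhiExt θ ε hu⟩⟩,
    -- The bound `ε₀ = 1` suffices, since the wind is shorter than one for every `ε < 1`.
    1, one_pos, fun θ ε hε => ?_⟩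
  · have h := isContactForm_alphaThetaDef 0 hε
    rwa [alphaThetaDef_zero_left] at h
  obtain ⟨ψ, hψ, hψf⟩ := exists_flow_doublyCovers (isDoubleCover_coverDef hε θ)
    (fun q hq => exists_coverDef_eq hε θ hq) (fun u hu v hv => coverDef_eq_iff hε θ hu hv) θ ε
  refine ⟨reebFlow θ ε, ψ, isReebFlow_reebFlow θ hε, ?_, hψ,
    fun hirr => ncard_periodicOrbits hε hirr hψf, ?_⟩
  · rintro ⟨p, hp⟩ t
    obtain ⟨u, hu, rfl⟩ := exists_coverDef_eq hε θ hp
    simp only [hψf _ u hu]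
    exact hasDerivAt_coverDef_rotFlow hε θ t hu
  · rintro ⟨n, rfl⟩ -
    have hc : cos (π / 2 + n * π) = 0 := by
      rw [cos_eq_zero_iff]
      exact ⟨n, by ring⟩
    have hκ : sin (π / 2 + n * π) ^ 2 = 1 := by
      rw [sin_sq, hc]
      ring
    exact ⟨fun p _ => ham_eq_norm_sub hc rfl ε p, randers ε, isFinsler_randers hε,
      isRanders_randers hε, fun p hp => isLUB_randers hc rfl hκ hε hp,
      isGeodesicFlow_randers hc rfl hκ hε hψf⟩
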